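/- **Notation.** $\mathcal D=C_c^\infty(\mathbb R)$ (real-valued), $\mathcal D'$ is the space of distributions on $\mathbb R$, and $T'$ is the distributional derivative, $\langle T',\phi\rangle=-\langle T,\phi'\rangle$. $C^0(\overline{\mathbb R})$ is the space of continuous $F:\mathbb R\to\mathbb R$ with real limits $F(\pm\infty)$ at $\pm\infty$, with the norm $\|F\|_\infty=\sup_{\mathbb R}|F|$; $\mathcal B_C$ is the subspace with $F(-\infty)=0$. $\mathcal A_C=\{f\in\mathcal D' : f=F'\text{ for some }F\in\mathcal B_C\}$; the primitive $F\in\mathcal B_C$ of $f$ is unique, $\int_a^b f=F(b)-F(a)$ for $a,b\in[-\infty,\infty]$, and $\|f\|=\sup_I|\int_I f|$ over all intervals $I\subset\mathbb R$ (Alexiewicz norm). $\mathcal{BV}$ is the space of $g:\mathbb R\to\mathbb R$ with finite variation $Vg$, with $g(\pm\infty)=\lim_{x\to\pm\infty}g(x)$ and $\|g\|_{\mathcal{BV}}=|g(-\infty)|+Vg$. For $f\in\mathcal A_C$ with primitive $F$ and $g\in\mathcal{BV}$, $\int_{-\infty}^\infty fg=F(\infty)g(\infty)-\int_{-\infty}^\infty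 F\,dg$, the last integral being a Henstock–Stieltjes integral over $[-\infty,\infty]$. With $r_x(t)=x-t$ and $\langle f\circ r_x,\phi\rangle=\langle f,\phi(x-\cdot)\rangle$, put $f*g(x)=\int_{-\infty}^\infty (f\circ r_x)\,g$ (that is, $\int f(x-y)g(y)\,dy$) and $g*f(x)=\int_{-\infty}^\infty f\,(g\circ r_x)$. Convolutions of functions with $L^1$ functions are Lebesgue integrals, $g*h(x)=\int g(x-y)h(y)\,dy$. Translations: $\tau_z g(x)=g(x-z)$, $\langle\tau_z f,\phi\rangle=\langle f,\tau_{-z}\phi\rangle$. The support of a function is the closure of the set where it does not vanish; the support of a distribution is the complement of the largest open set on which it vanishes. **Theorem.** Let $f\in\mathcal A_C$ and $g\in\mathcal{BV}$. Then: (a) $f*g(x)$ exists for every $x\in\mathbb R$. (b) $g*f$ exists on $\mathbb R$ and $f*g=g*f$. (c) $\|f*g\|_\infty\le\left|\int_{-\infty}^\infty f\right|\inf_{\mathbb R}|g|+\|f\|\,Vg\le\|f\|\,\|g\|_{\mathcal{BV}}$. (d) $f*g\in C^0(\overline{\mathbb R})$ and $\lim_{x\to\pm\infty}f*g(x)=g(\pm\infty)\int_{-\infty}^\infty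 f$. (e) If $h\in L^1(\mathbb R)$, then $g*h$ and $(f*g)*h$ exist on $\mathbb R$, $g*h\in\mathcal{BV}$, and $f*(g*h)=(f*g)*h\in C^0(\overline{\mathbb R})$. (f) For $x,z\in\mathbb R$: $\tau_zf\in\mathcal A_C$, $\tau_zg\in\mathcal{BV}$, and $\tau_z(f*g)(x)=((\tau_zf)*g)(x)=(f*\tau_zg)(x)$. (g) For each $f\in\mathcal A_C$, $\Phi_f:\mathcal{BV}\to C^0(\overline{\mathbb R})$, $\Phi_f[g]=f*g$, is a bounded linear operator with $\|\Phi_f\|\le\|f\|$, and there is a nonzero $f\in\mathcal A_C$ with $\|\Phi_f\|=\|f\|$. For each $g\in\mathcal{BV}$, $\Psi_g:\mathcal A_C\to C^0(\overline{\mathbb R})$, $\Psi_g[f]=f*g$, is a bounded linear operator with $\|\Psi_g\|\le\|g\|_{\mathcal{BV}}$, and there is a nonzero $g\in\mathcal{BV}$ with $\|\Psi_g\|=\|g\|_{\mathcal{BV}}$. Here an operator norm is the supremum of the norms of the images of the elements of norm $1$. (h) $\{x : f*g(x)\ne0\}\subset\operatorname{supp}(f)+\operatorname{supp}(g)$; hence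 $\operatorname{supp}(f*g)\subset\overline{\operatorname{supp}(f)+\operatorname{supp}(g)}$, and $\operatorname{supp}(f*g)\subset\operatorname{supp}(f)+\operatorname{supp}(g)$ whenever the right-hand side is closed. -/

import Mathlib

open MeasureTheory Filter Topology Set TopologicalSpace
open scoped Distributions LineDeriv Pointwise ContDiff

namespace ContPrimInt

/-! ### Test functions and distributions on the real line -/

/-- Real-valued test functions on `ℝ`. -/
abbrev TestFn : Type := TestFunction (⊤ : Opens ℝ) ℝ ⊤

/-- Distributions on `ℝ`. -/
abbrev Distr : Type := Distribution (⊤ : Opens ℝ) ℝ ⊤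

/-- Precomposition of a test function with a smooth homeomorphism `p` of `ℝ` such that
precomposition with `p` preserves the size of all derivatives. -/
noncomputable def testPrecomp (p : ℝ ≃ₜ ℝ) (hp : ContDiff ℝ ∞ p)
    (hd : ∀ (φ : ℝ → ℝ) (i : ℕ) (t : ℝ),
      ‖iteratedFDeriv ℝ i (fun s => φ (p s)) t‖ = ‖iteratedFDeriv ℝ i φ (p t)‖) :
    TestFn →L[ℝ] TestFn :=
  TestFunction.limitCLM ℝ
    (fun φ => ⟨fun s => φ (p s), φ.contDiff.comp hp,
      φ.hasCompactSupport.comp_homeomorph p, fun _ _ => trivial⟩)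
    (fun K _ => TestFunction.ofSupportedInCLM ℝ
        (K := K.map p.symm p.symm.continuous) (fun _ _ => trivial) ∘L
      ContDiffMapSupportedIn.mkCLM ℝ (fun φ s => φ (p s))
        (fun _ _ _ => rfl) (fun _ _ _ => rfl) (fun φ => φ.contDiff.comp hp)
        (fun φ s hs => φ.zero_on_compl (fun h => hs ⟨p s, h, by simp⟩))
        (fun i _ => ⟨{i}, 1, zero_le_one, fun φ s _ => by
          rw [hd, Finset.sup_singleton, one_mul]
          exact ContDiffMapSupportedIn.norm_iteratedFDeriv_apply_le_seminorm_top ℝ⟩))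
    (fun _ _ _ => rfl)

/-- Translation `φ ↦ φ(· - z)` of test functions. -/
noncomputable def translateTest (z : ℝ) : TestFn →L[ℝ] TestFn :=
  testPrecomp (Homeomorph.subRight z) (contDiff_id.sub contDiff_const) (fun φ i t => by
    simp [iteratedFDeriv_comp_sub])

/-- The reflection `φ ↦ φ(x - ·)` of test functions. -/
noncomputable def reflectTest (x : ℝ) : TestFn →L[ℝ] TestFn :=
  testPrecomp (Homeomorph.subLeft x) (contDiff_const.sub contDiff_id) (fun φ i t => by
    simp [norm_iteratedFDeriv_eq_norm_iteratedDeriv, iteratedDeriv_comp_const_sub])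

/-- The translate `τ_z f` of a distribution: `⟨τ_z f, φ⟩ = ⟨f, φ(· + z)⟩`. -/
noncomputable def translateDist (z : ℝ) (f : Distr) : Distr :=
  (translateTest (-z)).precompCompactConvergenceCLM ℝ f

/-- The composition `f ∘ r_x` of a distribution with `r_x(t) = x - t`, that is, `f(x - ·)`:
`⟨f ∘ r_x, φ⟩ = ⟨f, φ(x - ·)⟩`. -/
noncomputable def reflectDist (x : ℝ) (f : Distr) : Distr :=
  (reflectTest x).precompCompactConvergenceCLM ℝ f

@[simp] theorem translateDist_apply (z : ℝ) (f : Distr) (φ : TestFn) :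
    translateDist z f φ = f (translateTest (-z) φ) := rfl

@[simp] theorem reflectDist_apply (x : ℝ) (f : Distr) (φ : TestFn) :
    reflectDist x f φ = f (reflectTest x φ) := rfl

@[simp] theorem translateTest_apply (z : ℝ) (φ : TestFn) (s : ℝ) :
    translateTest z φ s = φ (s - z) := rfl

@[simp] theorem reflectTest_apply (x : ℝ) (φ : TestFn) (s : ℝ) :
    reflectTest x φ s = φ (x - s) := rfl

/-- The distribution `T_F : φ ↦ ∫ F φ` of a locally integrable function `F` (zero if `F` is not
locally integrable). -/
noncomputable def regularDist (F : ℝ → ℝ) : Distr where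
  toLinearMap := (TestFunction.integralAgainstBilinCLM (ContinuousLinearMap.mul ℝ ℝ) volume F :
    TestFn →L[ℝ] ℝ).toLinearMap
  cont := (TestFunction.integralAgainstBilinCLM (ContinuousLinearMap.mul ℝ ℝ) volume F :
    TestFn →L[ℝ] ℝ).cont

theorem regularDist_apply {F : ℝ → ℝ} (hF : Continuous F) (φ : TestFn) :
    regularDist F φ = ∫ t, φ t * F t := by
  change (TestFunction.integralAgainstBilinCLM (ContinuousLinearMap.mul ℝ ℝ) volume F :
    TestFn →L[ℝ] ℝ) φ = _
  rw [TestFunction.integralAgainstBilinCLM_eq_integral (hF.locallyIntegrable.locallyIntegrableOn _)]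
  rfl

theorem regularDist_add {F G : ℝ → ℝ} (hF : Continuous F) (hG : Continuous G) :
    regularDist (F + G) = regularDist F + regularDist G := by
  ext φ
  change regularDist (F + G) φ = regularDist F φ + regularDist G φ
  rw [regularDist_apply hF, regularDist_apply hG, regularDist_apply (hF.add hG),
    ← integral_add]
  · simp [mul_add]
  · exact (φ.continuous.mul hF).integrable_of_hasCompactSupport φ.hasCompactSupport.mul_right
  · exact (φ.continuous.mul hG).integrable_of_hasCompactSupport φ.hasCompactSupport.mul_right

theorem regularDist_smul (c : ℝ) {F : ℝ → ℝ} (hF : Continuous F) :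
    regularDist (c • F) = c • regularDist F := by
  ext φ
  change regularDist (c • F) φ = c * regularDist F φ
  rw [regularDist_apply hF, regularDist_apply (hF.const_smul c), ← integral_const_mul]
  simp [mul_left_comm]

/-! ### The function spaces -/

/-- `C⁰(ℝ̄)`: continuous functions on `ℝ` with real limits at `±∞`. -/
def C0bar : Submodule ℝ (ℝ → ℝ) where
  carrier := {F | Continuous F ∧ (∃ l, Tendsto F atBot (𝓝 l)) ∧ ∃ l, Tendsto F atTop (𝓝 l)}
  add_mem' := by
    rintro F G ⟨hF, ⟨a, ha⟩, ⟨b, hb⟩⟩ ⟨hG, ⟨c, hc⟩, ⟨d, hd⟩⟩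
    exact ⟨hF.add hG, ⟨_, ha.add hc⟩, ⟨_, hb.add hd⟩⟩
  zero_mem' := ⟨continuous_const, ⟨0, tendsto_const_nhds⟩, ⟨0, tendsto_const_nhds⟩⟩
  smul_mem' := by
    rintro c F ⟨hF, ⟨a, ha⟩, ⟨b, hb⟩⟩
    exact ⟨hF.const_smul c, ⟨_, ha.const_smul c⟩, ⟨_, hb.const_smul c⟩⟩

/-- `B_C`: continuous functions on `ℝ` with limit `0` at `-∞` and a real limit at `∞`. -/
def BC : Submodule ℝ (ℝ → ℝ) where
  carrier := {F | Continuous F ∧ Tendsto F atBot (𝓝 0) ∧ ∃ l, Tendsto F atTop (𝓝 l)}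
  add_mem' := by
    rintro F G ⟨hF, ha, ⟨b, hb⟩⟩ ⟨hG, hc, ⟨d, hd⟩⟩
    exact ⟨hF.add hG, by simpa using! ha.add hc, ⟨_, hb.add hd⟩⟩
  zero_mem' := ⟨continuous_const, tendsto_const_nhds, ⟨0, tendsto_const_nhds⟩⟩
  smul_mem' := by
    rintro c F ⟨hF, ha, ⟨b, hb⟩⟩
    exact ⟨hF.const_smul c, by simpa using! ha.const_smul c, ⟨_, hb.const_smul c⟩⟩

/-- `F ∈ B_C` is a primitive of `f` when `f` is the distributional derivative of `F`. -/
def IsPrimitive (F : ℝ → ℝ) (f : Distr) : Prop :=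
  F ∈ BC ∧ ∂_{(1 : ℝ)} (regularDist F) = f

/-- `A_C`: the integrable distributions, i.e. distributional derivatives of elements of `B_C`. -/
noncomputable def AC : Submodule ℝ Distr where
  carrier := {f | ∃ F, IsPrimitive F f}
  add_mem' := by
    rintro f g ⟨F, hF, rfl⟩ ⟨G, hG, rfl⟩
    exact ⟨F + G, BC.add_mem hF hG, by
      rw [regularDist_add hF.1 hG.1, LineDeriv.lineDerivOp_add]⟩
  zero_mem' := ⟨0, BC.zero_mem, by
    have h : regularDist 0 = 0 := by simpa using regularDist_smul 0 (F := 0) continuous_const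
    ext φ
    rw [h]
    simp⟩
  smul_mem' := by
    rintro c f ⟨F, hF, rfl⟩
    exact ⟨c • F, BC.smul_mem c hF, by
      rw [regularDist_smul c hF.1, LineDeriv.lineDerivOp_smul]⟩

/-- `BV`: functions of bounded variation on `ℝ`. -/
def BV : Submodule ℝ (ℝ → ℝ) where
  carrier := {g | BoundedVariationOn g univ}
  add_mem' := by
    intro f g hf hg
    refine ne_top_of_le_ne_top (ENNReal.add_ne_top.2 ⟨hf, hg⟩) (iSup_le fun p => ?_)
    calc ∑ i ∈ Finset.range p.1, edist ((f + g) (p.2.1 (i + 1))) ((f + g) (p.2.1 i))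
        ≤ ∑ i ∈ Finset.range p.1, (edist (f (p.2.1 (i + 1))) (f (p.2.1 i)) +
            edist (g (p.2.1 (i + 1))) (g (p.2.1 i))) :=
          Finset.sum_le_sum fun _ _ => edist_add_add_le _ _ _ _
      _ ≤ eVariationOn f univ + eVariationOn g univ := by
          rw [Finset.sum_add_distrib]
          exact add_le_add (eVariationOn.sum_le p.2.2.1 p.2.2.2)
            (eVariationOn.sum_le p.2.2.1 p.2.2.2)
  zero_mem' := by
    have h : eVariationOn (0 : ℝ → ℝ) univ = 0 :=
      eVariationOn.constant_on (by rintro _ ⟨_, _, rfl⟩ _ ⟨_, _, rfl⟩; rfl)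
    exact h.trans_ne ENNReal.zero_ne_top
  smul_mem' := fun c _ hf =>
    ((lipschitzWith_smul (β := ℝ) c).lipschitzOnWith (s := univ)).comp_boundedVariationOn
      (mapsTo_univ _ _) hf

/-! ### The continuous primitive integral -/

open Classical in
/-- The primitive in `B_C` of `f ∈ A_C` (zero if `f ∉ A_C`). -/
noncomputable def primitive (f : Distr) : ℝ → ℝ :=
  if h : ∃ F, IsPrimitive F f then h.choose else 0

open Classical in
/-- The extension of a function on `ℝ` to `[-∞, ∞]` by its limits at `±∞`. -/
noncomputable def extendReal (F : ℝ → ℝ) (x : EReal) : ℝ :=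
  if x = ⊥ then limUnder atBot F else if x = ⊤ then limUnder atTop F else F x.toReal

/-- `∫_a^b f = F(b) - F(a)` for `f ∈ A_C` with primitive `F ∈ B_C`, and `a, b ∈ [-∞, ∞]`. -/
noncomputable def acIntegral (f : Distr) (a b : EReal) : ℝ :=
  extendReal (primitive f) b - extendReal (primitive f) a

/-- The Alexiewicz norm `‖f‖ = sup_I |∫_I f|`, over all intervals `I` of `ℝ`. -/
noncomputable def alexNorm (f : Distr) : ℝ :=
  sSup {r | ∃ a b : EReal, a ≤ b ∧ r = |acIntegral f a b|}

/-- The variation `Vg` on `ℝ`. -/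
noncomputable def variation (g : ℝ → ℝ) : ℝ := (eVariationOn g univ).toReal

/-- `‖g‖_BV = |g(-∞)| + Vg`. -/
noncomputable def bvNorm (g : ℝ → ℝ) : ℝ := |limUnder atBot g| + variation g

/-- The uniform norm on `ℝ`. -/
noncomputable def supNorm (h : ℝ → ℝ) : ℝ := ⨆ x, |h x|

/-- `[-∞, ∞]` is partitioned by `-∞ = t 0 < t 1 < ⋯ < t N = ∞`, with tags
`z n ∈ [t n, t (n + 1)]`, and the partition is fine for the gauge `γ`. -/
def IsFinePartition (γ : EReal → Set EReal) (N : ℕ) (t z : ℕ → EReal) : Prop :=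
  t 0 = ⊥ ∧ t N = ⊤ ∧ ∀ n < N, t n < t (n + 1) ∧ z n ∈ Icc (t n) (t (n + 1)) ∧
    Icc (t n) (t (n + 1)) ⊆ γ (z n)

/-- A gauge on `[-∞, ∞]` assigns to each point an open interval of `[-∞, ∞]` containing it. -/
def IsGauge (γ : EReal → Set EReal) : Prop :=
  ∀ z, z ∈ γ z ∧ IsOpen (γ z) ∧ (γ z).OrdConnected

/-- The Henstock–Stieltjes integral `∫_{-∞}^{∞} F dg` exists and equals `I`. -/
def HasHSIntegral (F g : EReal → ℝ) (I : ℝ) : Prop :=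
  ∀ ε > 0, ∃ γ, IsGauge γ ∧ ∀ N t z, IsFinePartition γ N t z →
    |∑ n ∈ Finset.range N, F (z n) * (g (t (n + 1)) - g (t n)) - I| < ε

/-- `∫_{-∞}^{∞} f g` exists and equals `I`, the integral being defined by parts:
`∫ f g = F(∞) g(∞) - ∫ F dg` with `F ∈ B_C` the primitive of `f`. -/
def HasMulIntegral (f : Distr) (g : ℝ → ℝ) (I : ℝ) : Prop :=
  ∃ J, HasHSIntegral (extendReal (primitive f)) (extendReal g) J ∧
    I = extendReal (primitive f) ⊤ * extendReal g ⊤ - J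

open Classical in
/-- The value of `∫_{-∞}^{∞} f g` (zero if the integral does not exist). -/
noncomputable def mulIntegral (f : Distr) (g : ℝ → ℝ) : ℝ :=
  if h : ∃ I, HasMulIntegral f g I then h.choose else 0

/-! ### Convolutions -/

/-- `f ∗ g (x) = ∫ f(x - y) g(y) dy = ∫ (f ∘ r_x) g`. -/
noncomputable def conv (f : Distr) (g : ℝ → ℝ) (x : ℝ) : ℝ :=
  mulIntegral (reflectDist x f) g

/-- `g ∗ f (x) = ∫ g(x - y) f(y) dy = ∫ f (g ∘ r_x)`. -/
noncomputable def convSwap (g : ℝ → ℝ) (f : Distr) (x : ℝ) : ℝ :=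
  mulIntegral f (fun y => g (x - y))

/-- The convolution `g ∗ h (x) = ∫ g(x - y) h(y) dy` of functions, as a Lebesgue integral. -/
noncomputable def fnConv (g h : ℝ → ℝ) (x : ℝ) : ℝ := ∫ y, g (x - y) * h y

/-- The linear operator `Φ` is bounded with operator norm `C = sup_{‖v‖ = 1} ‖Φ v‖`, for the
norms `NV` and `NW`. -/
structure HasOperatorNorm {V W : Type} [AddCommGroup V] [Module ℝ V] [AddCommGroup W]
    [Module ℝ W] (NV : V → ℝ) (NW : W → ℝ) (Φ : V →ₗ[ℝ] W) (C : ℝ) : Prop where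
  bound : ∀ v, NW (Φ v) ≤ C * NV v
  isLUB : IsLUB {r | ∃ v, NV v = 1 ∧ r = NW (Φ v)} C

end ContPrimInt

open ContPrimInt

/-!
Everything is reduced to Lebesgue integrals by a density argument.

*Existence and approximation.* For `u ∈ L¹` with primitive `U` and `g ∈ BV`, the integral by parts
`U(∞) g(∞) - ∫ U dg` exists and equals the Lebesgue integral `∫ u g` (`hasParts_lebPrim`): on a
piece `[t, t']` the term `U(z) (g(t') - g(t))` differs from the increment of `U g - ∫ u g` by at
most `∫_t^{t'} |u|` times the variation of `g` over the piece, and a gauge makes the first factor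
small. Together with Cousin's lemma (`IsGauge.exists_isFinePartition`), which gives uniqueness of
Henstock–Stieltjes integrals, and the bound of Riemann sums by `sup |F| * Vg`, this gives existence
for every `F ∈ B_C`, because primitives of continuous compactly supported functions are uniformly
dense in `B_C` (`exists_lebPrim_approx`). Consequently `f ∗ g` is a uniform limit of classical
convolutions `u n ∗ g`, with the same `u n` for all `g` (`exists_approx_seq`). Commutativity,
continuity, the limits at `±∞` and associativity pass to the limit from the classical case, where
they are dominated convergence and Fubini's theorem.

*The estimate.* Writing `F(∞) g(∞) - ∫ F dg` as `F(∞) g(c) + ∫_c^∞ (F(∞) - F) dg - ∫_{-∞}^c F dg`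
and bounding both factors `F(∞) - F` and `F` by the Alexiewicz norm gives the uniform estimate
(`HasParts.abs_le`). It is attained for `g = 1` and `f` the characteristic function of `[0, 1]`,
which gives the sharpness of the operator norms.

*Distributions.* A local du Bois-Reymond lemma (`eq_center_of_integral_deriv_mul_eq_zero`) shows
that the primitive is unique and that it is locally constant off the support of `f`. In the Riemann
sums for `∫ f (g ∘ r_x)` with `x ∉ supp f + supp g`, near each real point either `F` is constant or
`g ∘ r_x` vanishes, so the sums telescope to `F(∞) (g ∘ r_x)(∞)` up to small contributions from
the endpoints, and `f ∗ g(x) = 0` (`hasParts_zero_of_local`).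
-/

namespace ContPrimInt

open scoped Convolution

/-! ### The Henstock–Stieltjes integral on the extended real line -/

theorem IsGauge.inter {γ₁ γ₂ : EReal → Set EReal} (h₁ : IsGauge γ₁) (h₂ : IsGauge γ₂) :
    IsGauge fun z => γ₁ z ∩ γ₂ z := fun z =>
  ⟨⟨(h₁ z).1, (h₂ z).1⟩, (h₁ z).2.1.inter (h₂ z).2.1, (h₁ z).2.2.inter (h₂ z).2.2⟩

theorem IsFinePartition.mono {γ₁ γ₂ : EReal → Set EReal} (h : ∀ z, γ₁ z ⊆ γ₂ z) {N : ℕ}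
    {t z : ℕ → EReal} (ht : IsFinePartition γ₁ N t z) : IsFinePartition γ₂ N t z :=
  ⟨ht.1, ht.2.1, fun n hn => ⟨(ht.2.2 n hn).1, (ht.2.2 n hn).2.1, (ht.2.2 n hn).2.2.trans (h _)⟩⟩

/-- Cousin's lemma on `[-∞, ∞]`: every gauge admits a fine tagged partition. -/
theorem IsGauge.exists_isFinePartition {γ : EReal → Set EReal} (hγ : IsGauge γ) :
    ∃ N t z, IsFinePartition γ N t z := by
  -- `D w`: there is a fine partition of `[-∞, w]`
  let D : EReal → Prop := fun w => ∃ N, ∃ t z : ℕ → EReal, t 0 = ⊥ ∧ t N = w ∧ ∀ n < N,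
    t n < t (n + 1) ∧ z n ∈ Icc (t n) (t (n + 1)) ∧ Icc (t n) (t (n + 1)) ⊆ γ (z n)
  have hD0 : D ⊥ := ⟨0, fun _ => ⊥, fun _ => ⊥, rfl, rfl, by simp⟩
  have hext : ∀ w w' c, D w → w < w' → c ∈ Icc w w' → Icc w w' ⊆ γ c → D w' := by
    rintro w w' c ⟨N, t, z, h0, rfl, h⟩ hw hc hs
    refine ⟨N + 1, fun n => if n ≤ N then t n else w', fun n => if n < N then z n else c,
      by simp [h0], by simp, fun n hn => ?_⟩
    rcases Nat.lt_succ_iff_lt_or_eq.1 hn with hn | rfl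
    · simpa [hn, hn.le, Nat.succ_le_of_lt hn] using h n hn
    · simpa using ⟨hw, hc, hs⟩
  set c := sSup {w | D w} with hc
  have hDc : D c := by
    rcases eq_or_ne c ⊥ with h | h
    · rwa [h]
    obtain ⟨a, ha, hac⟩ := exists_Ioc_subset_of_mem_nhds ((hγ c).2.1.mem_nhds (hγ c).1)
      ⟨⊥, bot_lt_iff_ne_bot.2 h⟩
    obtain ⟨w, hw, haw⟩ := lt_sSup_iff.1 ha
    have hwc : w ≤ c := le_sSup hw
    rcases hwc.eq_or_lt with h | h
    · rwa [← h]
    · exact hext w c c hw h ⟨hwc, le_rfl⟩ fun x hx => hac ⟨haw.trans_le hx.1, hx.2⟩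
  have hct : c = ⊤ := by
    by_contra h
    obtain ⟨b, hb, hcb⟩ := exists_Ico_subset_of_mem_nhds ((hγ c).2.1.mem_nhds (hγ c).1)
      ⟨⊤, lt_top_iff_ne_top.2 h⟩
    obtain ⟨d, hcd, hdb⟩ := exists_between hb
    exact (le_sSup (a := d) (hext c d c hDc hcd ⟨le_rfl, hcd.le⟩ fun x hx =>
      hcb ⟨hx.1, hx.2.trans_lt hdb⟩)).not_gt hcd
  obtain ⟨N, t, z, h0, hN, h⟩ := hDc
  exact ⟨N, t, z, h0, hN.trans hct, h⟩

/-- A bound valid for all Riemann sums passes to the integral. -/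
theorem HasHSIntegral.abs_sub_le {F g : EReal → ℝ} {I : ℝ} (h : HasHSIntegral F g I) {K C : ℝ}
    (hC : ∀ (N : ℕ) (t z : ℕ → EReal), t 0 = ⊥ → t N = ⊤ → (∀ n < N, t n ≤ t (n + 1)) →
      |∑ n ∈ Finset.range N, F (z n) * (g (t (n + 1)) - g (t n)) - K| ≤ C) :
    |I - K| ≤ C := by
  refine le_of_forall_pos_le_add fun ε hε => ?_
  obtain ⟨γ, hγ, hI⟩ := h ε hε
  obtain ⟨N, t, z, ht⟩ := hγ.exists_isFinePartition
  have h1 := hI N t z ht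
  have h2 := hC N t z ht.1 ht.2.1 fun n hn => (ht.2.2 n hn).1.le
  rw [abs_sub_comm] at h1
  have := _root_.abs_sub_le I (∑ n ∈ Finset.range N, F (z n) * (g (t (n + 1)) - g (t n))) K
  linarith

/-- Bilinearity of the integral: `F dg = a F₁ dg₁ + b F₂ dg₂` termwise gives the same relation
between the integrals. -/
theorem HasHSIntegral.linearComb {F₁ F₂ F g₁ g₂ g : EReal → ℝ} {I₁ I₂ a b : ℝ}
    (h₁ : HasHSIntegral F₁ g₁ I₁) (h₂ : HasHSIntegral F₂ g₂ I₂)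
    (h : ∀ z t t', F z * (g t' - g t) =
      a * (F₁ z * (g₁ t' - g₁ t)) + b * (F₂ z * (g₂ t' - g₂ t))) :
    HasHSIntegral F g (a * I₁ + b * I₂) := by
  intro ε hε
  have hδ : 0 < ε / (|a| + |b| + 1) := by positivity
  obtain ⟨γ₁, hγ₁, H₁⟩ := h₁ _ hδ
  obtain ⟨γ₂, hγ₂, H₂⟩ := h₂ _ hδ
  refine ⟨_, hγ₁.inter hγ₂, fun N t z ht => ?_⟩
  have A := H₁ N t z (ht.mono fun _ => inter_subset_left)
  have B := H₂ N t z (ht.mono fun _ => inter_subset_right)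
  rw [Finset.sum_congr rfl fun n _ => h (z n) (t n) (t (n + 1)), Finset.sum_add_distrib,
    ← Finset.mul_sum, ← Finset.mul_sum]
  set S₁ := ∑ n ∈ Finset.range N, F₁ (z n) * (g₁ (t (n + 1)) - g₁ (t n))
  set S₂ := ∑ n ∈ Finset.range N, F₂ (z n) * (g₂ (t (n + 1)) - g₂ (t n))
  calc |a * S₁ + b * S₂ - (a * I₁ + b * I₂)| = |a * (S₁ - I₁) + b * (S₂ - I₂)| := by ring_nf
    _ ≤ |a| * |S₁ - I₁| + |b| * |S₂ - I₂| := by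
        simpa only [abs_mul] using abs_add_le (a * (S₁ - I₁)) (b * (S₂ - I₂))
    _ ≤ |a| * (ε / (|a| + |b| + 1)) + |b| * (ε / (|a| + |b| + 1)) := by gcongr
    _ < ε := by
        rw [← add_mul, mul_div_assoc', div_lt_iff₀ (by positivity)]
        nlinarith

theorem HasHSIntegral.unique {F g : EReal → ℝ} {I₁ I₂ : ℝ} (h₁ : HasHSIntegral F g I₁)
    (h₂ : HasHSIntegral F g I₂) : I₁ = I₂ := by
  have h := (h₁.linearComb h₂ (F := 0) (g := 0) (a := 1) (b := -1) (by simp)).abs_sub_le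
    (K := 0) (C := 0) (by simp)
  have := abs_nonpos_iff.1 h
  linarith

/-- A criterion for integrability: it suffices to compare each term of a Riemann sum with the
increment of a function `P`, up to a small multiple of the increment of some function `V`. -/
theorem hasHSIntegral_of_local {F g : EReal → ℝ} (P V : EReal → ℝ)
    (h : ∀ ε > 0, ∃ γ, IsGauge γ ∧ ∀ t z t', t < t' → z ∈ Icc t t' → Icc t t' ⊆ γ z →
      |F z * (g t' - g t) - (P t' - P t)| ≤ ε * (V t' - V t)) :
    HasHSIntegral F g (P ⊤ - P ⊥) := by
  intro ε hε
  have hδ : 0 < ε / (|V ⊤ - V ⊥| + 1) := by positivity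
  obtain ⟨γ, hγ, H⟩ := h _ hδ
  refine ⟨γ, hγ, fun N t z ht => ?_⟩
  have hP : P ⊤ - P ⊥ = ∑ n ∈ Finset.range N, (P (t (n + 1)) - P (t n)) := by
    rw [Finset.sum_range_sub fun n => P (t n), ht.1, ht.2.1]
  rw [hP, ← Finset.sum_sub_distrib]
  calc _ ≤ ∑ n ∈ Finset.range N,
        |F (z n) * (g (t (n + 1)) - g (t n)) - (P (t (n + 1)) - P (t n))| :=
        Finset.abs_sum_le_sum_abs _ _
    _ ≤ ∑ n ∈ Finset.range N, ε / (|V ⊤ - V ⊥| + 1) * (V (t (n + 1)) - V (t n)) := by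
        refine Finset.sum_le_sum fun n hn => ?_
        have := ht.2.2 n (Finset.mem_range.1 hn)
        exact H _ _ _ this.1 this.2.1 this.2.2
    _ = ε / (|V ⊤ - V ⊥| + 1) * (V ⊤ - V ⊥) := by
        rw [← Finset.mul_sum, Finset.sum_range_sub fun n => V (t n), ht.1, ht.2.1]
    _ < ε := by
        rw [div_mul_eq_mul_div, div_lt_iff₀ (by positivity)]
        nlinarith [le_abs_self (V ⊤ - V ⊥)]

theorem monotoneOn_Iic_of_le_succ {α : Type*} [LinearOrder α] {t : ℕ → α} {N : ℕ}
    (h : ∀ n < N, t n ≤ t (n + 1)) :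
    MonotoneOn t (Iic N) := by
  intro i _ j hj hij
  induction j, hij using Nat.le_induction with
  | base => exact le_rfl
  | succ j hij ih =>
    have hj' : j < N := hj
    exact (ih (mem_Iic.2 hj'.le)).trans (h j hj')

theorem sum_abs_sub_le_variation {α : Type*} [LinearOrder α] {g : α → ℝ}
    (hg : BoundedVariationOn g univ) {t : ℕ → α} {N : ℕ} (h : ∀ n < N, t n ≤ t (n + 1)) :
    ∑ n ∈ Finset.range N, |g (t (n + 1)) - g (t n)| ≤ (eVariationOn g univ).toReal := by
  have := eVariationOn.sum_le_of_monotoneOn_Iic (f := g) (monotoneOn_Iic_of_le_succ h)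
    (fun i _ => mem_univ (t i))
  rw [← ENNReal.ofReal_le_iff_le_toReal hg, ENNReal.ofReal_sum_of_nonneg fun _ _ => abs_nonneg _]
  simpa only [edist_dist, Real.dist_eq] using this

theorem HasHSIntegral.abs_le {F g : EReal → ℝ} {I ε : ℝ} (h : HasHSIntegral F g I)
    (hg : BoundedVariationOn g univ) (hF : ∀ w, |F w| ≤ ε) :
    |I| ≤ ε * (eVariationOn g univ).toReal := by
  have hε : 0 ≤ ε := (abs_nonneg _).trans (hF 0)
  rw [← sub_zero I]
  refine h.abs_sub_le fun N t z _ _ ht => ?_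
  rw [sub_zero]
  calc _ ≤ ∑ n ∈ Finset.range N, |F (z n) * (g (t (n + 1)) - g (t n))| :=
        Finset.abs_sum_le_sum_abs _ _
    _ ≤ ∑ n ∈ Finset.range N, ε * |g (t (n + 1)) - g (t n)| :=
        Finset.sum_le_sum fun n _ => by rw [abs_mul]; gcongr; exact hF _
    _ ≤ _ := by
        rw [← Finset.mul_sum]
        gcongr
        exact sum_abs_sub_le_variation hg ht

/-- Integrability with respect to a function of bounded variation passes to uniform limits. -/
theorem exists_hasHSIntegral_of_approx {F g : EReal → ℝ} (hg : BoundedVariationOn g univ)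
    (h : ∀ ε > 0, ∃ F₀ I₀, HasHSIntegral F₀ g I₀ ∧ ∀ w, |F w - F₀ w| ≤ ε) :
    ∃ I, HasHSIntegral F g I := by
  set W := (eVariationOn g univ).toReal with hW
  have hW0 : 0 ≤ W := ENNReal.toReal_nonneg
  choose! F₀ I₀ hI hF using h
  -- the integrals `I₀ (e n)` of the approximations form a Cauchy sequence
  let e : ℕ → ℝ := fun n => 1 / ((n : ℝ) + 1)
  have he : ∀ n, 0 < e n := fun n => by positivity
  have he0 : Tendsto e atTop (𝓝 0) := tendsto_one_div_add_atTop_nhds_zero_nat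
  have hdist : ∀ a > 0, ∀ b > 0, |I₀ a - I₀ b| ≤ (a + b) * W := by
    intro a ha b hb
    have := (((hI a ha).linearComb (hI b hb) (F := F₀ a - F₀ b) (g := g) (a := 1) (b := -1)
      (by intros; simp only [Pi.sub_apply]; ring)).abs_le hg (ε := a + b) fun w => ?_)
    · convert this using 2
      ring
    · have h1 := abs_le.1 (hF a ha w)
      have h2 := abs_le.1 (hF b hb w)
      exact abs_le.2 ⟨by simp only [Pi.sub_apply]; linarith, by simp only [Pi.sub_apply]; linarith⟩
  have hc : CauchySeq fun n => I₀ (e n) := by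
    refine cauchySeq_of_le_tendsto_0 (fun n => 2 * e n * W) (fun n m k hn hm => ?_) ?_
    · rw [Real.dist_eq]
      refine (hdist _ (he n) _ (he m)).trans ?_
      have h1 : e n ≤ e k := one_div_le_one_div_of_le (by positivity) (by gcongr)
      have h2 : e m ≤ e k := one_div_le_one_div_of_le (by positivity) (by gcongr)
      nlinarith
    · simpa using (he0.const_mul 2).mul_const W
  obtain ⟨I, hI'⟩ := cauchySeq_tendsto_of_complete hc
  refine ⟨I, fun ε hε => ?_⟩
  have h1 : ∀ᶠ n in atTop, e n * W < ε / 3 := by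
    have : Tendsto (fun n => e n * W) atTop (𝓝 (0 * W)) := he0.mul_const W
    exact this.eventually (gt_mem_nhds (by simpa using by positivity))
  have h2 : ∀ᶠ n in atTop, |I₀ (e n) - I| < ε / 3 := by
    have := (Metric.tendsto_nhds.1 hI') (ε / 3) (by positivity)
    simpa only [Real.dist_eq] using this
  obtain ⟨n, hn1, hn2⟩ := (h1.and h2).exists
  obtain ⟨γ, hγ, H⟩ := hI (e n) (he n) (ε / 3) (by positivity)
  refine ⟨γ, hγ, fun N t z ht => ?_⟩
  have h3 := H N t z ht
  have h4 : |∑ k ∈ Finset.range N, F (z k) * (g (t (k + 1)) - g (t k)) -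
      ∑ k ∈ Finset.range N, F₀ (e n) (z k) * (g (t (k + 1)) - g (t k))| ≤ e n * W := by
    rw [← Finset.sum_sub_distrib]
    calc _ ≤ ∑ k ∈ Finset.range N, |F (z k) * (g (t (k + 1)) - g (t k)) -
          F₀ (e n) (z k) * (g (t (k + 1)) - g (t k))| := Finset.abs_sum_le_sum_abs _ _
      _ ≤ ∑ k ∈ Finset.range N, e n * |g (t (k + 1)) - g (t k)| :=
          Finset.sum_le_sum fun k _ => by
            rw [← sub_mul, abs_mul]; gcongr; exact hF _ (he n) _
      _ ≤ _ := by
          rw [← Finset.mul_sum]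
          have := (he n).le
          gcongr
          exact sum_abs_sub_le_variation hg fun k hk => (ht.2.2 k hk).1.le
  rw [abs_lt] at *
  rw [abs_le] at h4
  constructor <;> linarith

/-! ### Extension to the extended real line -/

@[simp] theorem extendReal_coe (F : ℝ → ℝ) (x : ℝ) : extendReal F x = F x := by
  simp [extendReal]

theorem extendReal_top {F : ℝ → ℝ} {l : ℝ} (h : Tendsto F atTop (𝓝 l)) :
    extendReal F ⊤ = l := by
  simp [extendReal, h.limUnder_eq]

theorem extendReal_bot {F : ℝ → ℝ} {l : ℝ} (h : Tendsto F atBot (𝓝 l)) :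
    extendReal F ⊥ = l := by
  simp [extendReal, h.limUnder_eq]

/-- A function on `[-∞, ∞]` continuous at `±∞` is the extension of its restriction to `ℝ`. -/
theorem eq_extendReal {F : ℝ → ℝ} {G : EReal → ℝ} (h : ∀ x : ℝ, G x = F x)
    (ht : ContinuousAt G ⊤) (hb : ContinuousAt G ⊥) : G = extendReal F := by
  have hG : F = fun x : ℝ => G x := funext fun x => (h x).symm
  ext w
  induction w with
  | bot =>
    rw [extendReal_bot (l := G ⊥)]
    rw [hG]
    exact hb.tendsto.comp EReal.tendsto_coe_atBot
  | coe x => simp [h]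
  | top =>
    rw [extendReal_top (l := G ⊤)]
    rw [hG]
    exact ht.tendsto.comp EReal.tendsto_coe_atTop

theorem tendsto_extendReal_top {F : ℝ → ℝ} {l : ℝ} (h : Tendsto F atTop (𝓝 l)) :
    Tendsto (extendReal F) (𝓝 ⊤) (𝓝 l) := by
  rw [← nhdsNE_sup_pure, EReal.nhdsWithin_top, tendsto_sup, tendsto_pure_left, tendsto_map'_iff]
  refine ⟨h.congr fun x => (extendReal_coe F x).symm, fun s hs => ?_⟩
  rw [extendReal_top h]
  exact mem_of_mem_nhds hs

theorem tendsto_extendReal_bot {F : ℝ → ℝ} {l : ℝ} (h : Tendsto F atBot (𝓝 l)) :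
    Tendsto (extendReal F) (𝓝 ⊥) (𝓝 l) := by
  rw [← nhdsNE_sup_pure, EReal.nhdsWithin_bot, tendsto_sup, tendsto_pure_left, tendsto_map'_iff]
  refine ⟨h.congr fun x => (extendReal_coe F x).symm, fun s hs => ?_⟩
  rw [extendReal_bot h]
  exact mem_of_mem_nhds hs

theorem extendReal_linearComb {F G : ℝ → ℝ} {k l m n : ℝ} (hF : Tendsto F atBot (𝓝 k))
    (hF' : Tendsto F atTop (𝓝 l)) (hG : Tendsto G atBot (𝓝 m)) (hG' : Tendsto G atTop (𝓝 n))
    (a b : ℝ) : extendReal (a • F + b • G) = a • extendReal F + b • extendReal G := by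
  refine (eq_extendReal (by simp) ?_ ?_).symm
  · simp only [ContinuousAt, Pi.add_apply, Pi.smul_apply, extendReal_top hF', extendReal_top hG']
    exact ((tendsto_extendReal_top hF').const_smul a).add
      ((tendsto_extendReal_top hG').const_smul b)
  · simp only [ContinuousAt, Pi.add_apply, Pi.smul_apply, extendReal_bot hF, extendReal_bot hG]
    exact ((tendsto_extendReal_bot hF).const_smul a).add
      ((tendsto_extendReal_bot hG).const_smul b)

theorem abs_extendReal_sub_le {F G : ℝ → ℝ} {a b c d ε : ℝ} (hF : Tendsto F atBot (𝓝 a))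
    (hF' : Tendsto F atTop (𝓝 b)) (hG : Tendsto G atBot (𝓝 c)) (hG' : Tendsto G atTop (𝓝 d))
    (h : ∀ x, |F x - G x| ≤ ε) (w : EReal) : |extendReal F w - extendReal G w| ≤ ε := by
  induction w with
  | bot =>
    rw [extendReal_bot hF, extendReal_bot hG]
    exact le_of_tendsto (hF.sub hG).abs (Eventually.of_forall h)
  | coe x => simpa using h x
  | top =>
    rw [extendReal_top hF', extendReal_top hG']
    exact le_of_tendsto (hF'.sub hG').abs (Eventually.of_forall h)

theorem exists_tendsto_atTop_of_mem_BV {g : ℝ → ℝ} (hg : g ∈ BV) :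
    ∃ l, Tendsto g atTop (𝓝 l) :=
  BoundedVariationOn.exists_tendsto_left_of_filter hg atTop
    (fun y _ => by simpa using Ici_mem_atTop y) univ_nonempty

theorem comp_antitone_mem_BV {g : ℝ → ℝ} (hg : g ∈ BV) {p : ℝ → ℝ} (hp : Antitone p) :
    (fun x => g (p x)) ∈ BV :=
  ne_top_of_le_ne_top hg
    (eVariationOn.comp_le_of_antitoneOn g p (hp.antitoneOn _) (mapsTo_univ _ _))

theorem comp_monotone_mem_BV {g : ℝ → ℝ} (hg : g ∈ BV) {p : ℝ → ℝ} (hp : Monotone p) :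
    (fun x => g (p x)) ∈ BV :=
  ne_top_of_le_ne_top hg
    (eVariationOn.comp_le_of_monotoneOn g p (hp.monotoneOn _) (mapsTo_univ _ _))

theorem exists_tendsto_atBot_of_mem_BV {g : ℝ → ℝ} (hg : g ∈ BV) :
    ∃ l, Tendsto g atBot (𝓝 l) := by
  obtain ⟨l, hl⟩ := exists_tendsto_atTop_of_mem_BV
    (comp_antitone_mem_BV hg (p := fun x => -x) fun _ _ h => neg_le_neg h)
  exact ⟨l, by simpa [Function.comp_def] using hl.comp tendsto_neg_atBot_atTop⟩

/-- Extending `g` by its limits at `±∞` does not increase the variation. -/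
theorem eVariationOn_extendReal_le {g : ℝ → ℝ} (hg : g ∈ BV) :
    eVariationOn (extendReal g) univ ≤ eVariationOn g univ := by
  obtain ⟨a, ha⟩ := exists_tendsto_atBot_of_mem_BV hg
  obtain ⟨b, hb⟩ := exists_tendsto_atTop_of_mem_BV hg
  -- truncate at `±n` and use lower semicontinuity of the variation
  let p : ℕ → EReal → ℝ := fun n w => (max (-(n : ℝ) : EReal) (min w (n : ℝ))).toReal
  have hfin : ∀ n w, max (-(n : ℝ) : EReal) (min w (n : ℝ)) ≠ ⊥ ∧
      max (-(n : ℝ) : EReal) (min w (n : ℝ)) ≠ ⊤ := by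
    intro n w
    rw [← EReal.coe_neg]
    exact ⟨((EReal.bot_lt_coe _).trans_le (le_max_left _ _)).ne',
      (max_lt (EReal.coe_lt_top _) ((min_le_right _ _).trans_lt (EReal.coe_lt_top _))).ne⟩
  have hp : ∀ n, Monotone (p n) := fun n w w' h => by
    refine EReal.toReal_le_toReal ?_ (hfin n w).1 (hfin n w').2
    gcongr
  have hlim : ∀ w ∈ (univ : Set EReal),
      Tendsto (fun n => (g ∘ p n) w) atTop (𝓝 (extendReal g w)) := by
    intro w _
    induction w with
    | bot =>
      rw [extendReal_bot ha]
      have : ∀ n, p n ⊥ = -(n : ℝ) := fun n => by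
        simp only [p, min_eq_left bot_le, max_eq_left bot_le, ← EReal.coe_neg, EReal.toReal_coe]
      simp only [Function.comp, this]
      exact ha.comp (tendsto_neg_atTop_atBot.comp tendsto_natCast_atTop_atTop)
    | top =>
      rw [extendReal_top hb]
      have : ∀ n, p n ⊤ = (n : ℝ) := fun n => by
        have h : (-(n : ℝ) : EReal) ≤ (n : ℝ) := by
          rw [← EReal.coe_neg, EReal.coe_le_coe_iff]
          linarith [(Nat.cast_nonneg n : (0 : ℝ) ≤ n)]
        simp only [p, min_eq_right le_top, max_eq_right h, EReal.toReal_coe]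
      simp only [Function.comp, this]
      exact hb.comp tendsto_natCast_atTop_atTop
    | coe x =>
      refine tendsto_const_nhds.congr' ?_
      filter_upwards [tendsto_natCast_atTop_atTop.eventually_ge_atTop |x|] with n hn
      have h := abs_le.1 hn
      have : p n x = x := by
        have h1 : ((x : ℝ) : EReal) ≤ (n : ℝ) := EReal.coe_le_coe_iff.2 h.2
        have h2 : (-(n : ℝ) : EReal) ≤ x := by
          rw [← EReal.coe_neg]; exact EReal.coe_le_coe_iff.2 h.1
        simp only [p, min_eq_left h1, max_eq_right h2, EReal.toReal_coe]
      simp [this]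
  by_contra! hlt
  obtain ⟨n, hn⟩ := (eVariationOn.lowerSemicontinuous_aux hlim hlt).exists
  exact hn.not_ge (eVariationOn.comp_le_of_monotoneOn g (p n) ((hp n).monotoneOn _)
    (mapsTo_univ _ _))

theorem boundedVariationOn_extendReal {g : ℝ → ℝ} (hg : g ∈ BV) :
    BoundedVariationOn (extendReal g) univ :=
  ne_top_of_le_ne_top hg (eVariationOn_extendReal_le hg)

theorem toReal_eVariationOn_extendReal_le {g : ℝ → ℝ} (hg : g ∈ BV) :
    (eVariationOn (extendReal g) univ).toReal ≤ variation g :=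
  ENNReal.toReal_mono hg (eVariationOn_extendReal_le hg)

/-! ### Functions of bounded variation as multipliers -/

theorem measurable_of_mem_BV {g : ℝ → ℝ} (hg : g ∈ BV) : Measurable g := by
  obtain ⟨p, q, hp, hq, rfl⟩ : ∃ p q, MonotoneOn p univ ∧ MonotoneOn q univ ∧ g = p - q :=
    (BoundedVariationOn.locallyBoundedVariationOn hg).exists_monotoneOn_sub_monotoneOn
  exact (monotoneOn_univ.1 hp).measurable.sub (monotoneOn_univ.1 hq).measurable

theorem abs_sub_le_variation {g : ℝ → ℝ} (hg : g ∈ BV) (x y : ℝ) : |g x - g y| ≤ variation g :=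
  BoundedVariationOn.dist_le hg (mem_univ x) (mem_univ y)

theorem abs_le_of_mem_BV {g : ℝ → ℝ} (hg : g ∈ BV) (x : ℝ) : |g x| ≤ |g 0| + variation g := by
  have h1 := abs_sub_le_variation hg x 0
  have h2 := abs_sub_abs_le_abs_sub (g x) (g 0)
  linarith

theorem integrable_mul_of_mem_BV {f g : ℝ → ℝ} (hf : Integrable f) (hg : g ∈ BV) :
    Integrable fun x => f x * g x :=
  hf.mul_bdd (c := |g 0| + variation g) (measurable_of_mem_BV hg).aestronglyMeasurable
    (Eventually.of_forall fun x => abs_le_of_mem_BV hg x)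

/-! ### Primitives of integrable functions -/

/-- The primitive `w ↦ ∫_{-∞}^w f` of an integrable function, on the extended real line. -/
noncomputable def lebPrim (f : ℝ → ℝ) (w : EReal) : ℝ := ∫ s in {s : ℝ | (s : EReal) ≤ w}, f s

theorem measurableSet_coe_le (w : EReal) : MeasurableSet {s : ℝ | (s : EReal) ≤ w} :=
  measurable_coe_real_ereal measurableSet_Iic

theorem continuous_lebPrim {f : ℝ → ℝ} (hf : Integrable f) : Continuous (lebPrim f) := by
  have h : lebPrim f = fun w => ∫ s, {s : ℝ | (s : EReal) ≤ w}.indicator f s :=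
    funext fun w => (integral_indicator (measurableSet_coe_le w)).symm
  rw [h, continuous_iff_continuousAt]
  intro w₀
  refine continuousAt_of_dominated (bound := fun s => |f s|)
    (Eventually.of_forall fun w => hf.aestronglyMeasurable.indicator (measurableSet_coe_le w))
    (Eventually.of_forall fun w => Eventually.of_forall fun s => norm_indicator_le_norm_self _ _)
    hf.abs ?_
  have hne : ∀ᵐ s : ℝ, (s : EReal) ≠ w₀ := by
    have : {s : ℝ | (s : EReal) = w₀}.Subsingleton := fun a ha b hb =>
      EReal.coe_eq_coe_iff.1 (Eq.trans ha (Eq.symm hb))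
    exact measure_eq_zero_iff_ae_notMem.1 (this.measure_zero volume)
  filter_upwards [hne] with s hs
  rcases lt_or_gt_of_ne hs with hs | hs
  · refine continuousAt_const.congr (f := fun _ => f s) ?_
    filter_upwards [lt_mem_nhds hs] with w hw
    simp [indicator, hw.le]
  · refine continuousAt_const.congr (f := fun _ => 0) ?_
    filter_upwards [gt_mem_nhds hs] with w hw
    simp [indicator, hw]

theorem lebPrim_coe (f : ℝ → ℝ) (x : ℝ) : lebPrim f x = ∫ s in Iic x, f s := by
  simp only [lebPrim, EReal.coe_le_coe_iff]
  rfl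

@[simp] theorem lebPrim_top (f : ℝ → ℝ) : lebPrim f ⊤ = ∫ s, f s := by simp [lebPrim]

@[simp] theorem lebPrim_bot (f : ℝ → ℝ) : lebPrim f ⊥ = 0 := by simp [lebPrim]

theorem lebPrim_mem_BC {f : ℝ → ℝ} (hf : Integrable f) : (fun x : ℝ => lebPrim f x) ∈ BC :=
  ⟨(continuous_lebPrim hf).comp continuous_coe_real_ereal,
    by simpa using! ((continuous_lebPrim hf).tendsto ⊥).comp EReal.tendsto_coe_atBot,
    _, ((continuous_lebPrim hf).tendsto ⊤).comp EReal.tendsto_coe_atTop⟩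

theorem extendReal_lebPrim {f : ℝ → ℝ} (hf : Integrable f) :
    extendReal (fun x : ℝ => lebPrim f x) = lebPrim f :=
  (eq_extendReal (fun _ => rfl) (continuous_lebPrim hf).continuousAt
    (continuous_lebPrim hf).continuousAt).symm

theorem lebPrim_sub {f : ℝ → ℝ} (hf : Integrable f) {a b : EReal} (hab : a ≤ b) :
    lebPrim f b - lebPrim f a = ∫ s in {s : ℝ | a < (s : EReal) ∧ (s : EReal) ≤ b}, f s := by
  have h : {s : ℝ | a < (s : EReal) ∧ (s : EReal) ≤ b} =
      {s : ℝ | (s : EReal) ≤ b} \ {s : ℝ | (s : EReal) ≤ a} := by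
    ext s
    simp [and_comm]
  have hsub : {s : ℝ | (s : EReal) ≤ a} ⊆ {s : ℝ | (s : EReal) ≤ b} := fun s hs =>
    le_trans hs hab
  rw [h, setIntegral_sdiff (measurableSet_coe_le a) hf.integrableOn hsub]
  rfl

theorem monotone_lebPrim_abs {f : ℝ → ℝ} (hf : Integrable f) :
    Monotone (lebPrim fun s => |f s|) := fun a b hab => by
  rw [← sub_nonneg, lebPrim_sub hf.abs hab]
  exact integral_nonneg fun s => abs_nonneg _

/-- Over an interval where `g` is within `D` of a constant `y`, the increments of `∫ f g` and of
`y ∫ f` differ by at most `D` times the increment of `∫ |f|`. -/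
theorem abs_lebPrim_mul_sub_le {f g : ℝ → ℝ} (hf : Integrable f)
    (hfg : Integrable fun s => f s * g s) {a b : EReal} (hab : a ≤ b) {y D : ℝ}
    (h : ∀ s : ℝ, a ≤ (s : EReal) → (s : EReal) ≤ b → |g s - y| ≤ D) :
    |lebPrim (fun s => f s * g s) b - lebPrim (fun s => f s * g s) a -
        (lebPrim f b - lebPrim f a) * y| ≤
      (lebPrim (fun s => |f s|) b - lebPrim (fun s => |f s|) a) * D := by
  have hm : MeasurableSet {s : ℝ | a < (s : EReal) ∧ (s : EReal) ≤ b} :=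
    measurable_coe_real_ereal measurableSet_Ioc
  rw [lebPrim_sub hfg hab, lebPrim_sub hf hab, lebPrim_sub hf.abs hab, ← integral_mul_const,
    ← integral_mul_const, ← integral_sub hfg.restrict (hf.mul_const y).restrict, ← Real.norm_eq_abs]
  refine norm_integral_le_of_norm_le (hf.abs.mul_const D).restrict ?_
  filter_upwards [ae_restrict_mem hm] with s hs
  rw [← mul_sub, norm_mul, Real.norm_eq_abs, Real.norm_eq_abs]
  gcongr
  exact h s hs.1.le hs.2

/-! ### The integral defined by parts, in terms of the primitive -/

/-- `I = F(∞) g(∞) - ∫ F dg`, the last integral existing as a Henstock–Stieltjes integral. -/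
def HasParts (F g : ℝ → ℝ) (I : ℝ) : Prop :=
  ∃ J, HasHSIntegral (extendReal F) (extendReal g) J ∧ I = extendReal F ⊤ * extendReal g ⊤ - J

theorem HasParts.unique {F g : ℝ → ℝ} {I₁ I₂ : ℝ} (h₁ : HasParts F g I₁) (h₂ : HasParts F g I₂) :
    I₁ = I₂ := by
  obtain ⟨J₁, h₁, rfl⟩ := h₁
  obtain ⟨J₂, h₂, rfl⟩ := h₂
  rw [h₁.unique h₂]

/-- For an absolutely continuous primitive, the integral defined by parts is the Lebesgue integral
of the product. -/
theorem hasParts_lebPrim {f g : ℝ → ℝ} (hf : Integrable f) (hg : g ∈ BV) :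
    HasParts (fun x : ℝ => lebPrim f x) g (∫ s, f s * g s) := by
  have hfg := integrable_mul_of_mem_BV hf hg
  set G := extendReal g with hG
  have hGV : BoundedVariationOn G univ := boundedVariationOn_extendReal hg
  set A := lebPrim fun s => |f s| with hA
  set Q := lebPrim fun s => f s * g s with hQ
  set V : EReal → ℝ := fun w => (eVariationOn G (Iic w)).toReal with hV
  -- the increments of `V` are the variations of `G` over intervals
  have hVle : ∀ t t' x y : EReal, t ≤ t' → x ∈ Icc t t' → y ∈ Icc t t' →
      |G x - G y| ≤ V t' - V t := by
    intro t t' x y htt hx hy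
    have hu := eVariationOn.union G (isGreatest_Iic (a := t)) (isLeast_Icc htt)
    rw [Iic_union_Icc_eq_Iic htt] at hu
    have h1 := (hGV.mono (subset_univ (Icc t t'))).dist_le hx hy
    simp only [hV]
    rw [hu, ENNReal.toReal_add (hGV.mono (subset_univ _)) (hGV.mono (subset_univ _))]
    rw [Real.dist_eq] at h1
    linarith
  have hloc : HasHSIntegral (lebPrim f) G
      ((lebPrim f ⊤ * G ⊤ - Q ⊤) - (lebPrim f ⊥ * G ⊥ - Q ⊥)) := by
    -- on a fine piece `∫ |f|` increases by at most `ε`; `γ z` is an interval as `A` is monotone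
    refine hasHSIntegral_of_local (fun w => lebPrim f w * G w - Q w) V fun ε hε =>
      ⟨fun z => A ⁻¹' Metric.ball (A z) (ε / 2), fun z => ⟨by simpa using hε,
        Metric.isOpen_ball.preimage (continuous_lebPrim hf.abs), ?_⟩, ?_⟩
    · simp only [Real.ball_eq_Ioo]
      exact ordConnected_Ioo.preimage_mono (monotone_lebPrim_abs hf)
    · intro t z t' htt hz hγ
      have h1 := abs_lebPrim_mul_sub_le hf hfg hz.1 (y := G t) (D := V t' - V t) fun s h1 h2 => by
        rw [← extendReal_coe g s]
        exact hVle t t' _ _ htt.le ⟨h1, h2.trans hz.2⟩ ⟨le_rfl, htt.le⟩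
      have h2 := abs_lebPrim_mul_sub_le hf hfg hz.2 (y := G t') (D := V t' - V t) fun s h1 h2 => by
        rw [← extendReal_coe g s]
        exact hVle t t' _ _ htt.le ⟨hz.1.trans h1, h2⟩ ⟨htt.le, le_rfl⟩
      have hV0 : 0 ≤ V t' - V t :=
        (abs_nonneg _).trans (hVle t t' t t htt.le ⟨le_rfl, htt.le⟩ ⟨le_rfl, htt.le⟩)
      have hA : A t' - A t ≤ ε := by
        have h3 : |A t - A z| < ε / 2 := hγ ⟨le_rfl, htt.le⟩
        have h4 : |A t' - A z| < ε / 2 := hγ ⟨htt.le, le_rfl⟩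
        have := (abs_lt.1 h3).1
        have := (abs_lt.1 h4).2
        linarith
      calc _ = |(Q z - Q t - (lebPrim f z - lebPrim f t) * G t) +
            (Q t' - Q z - (lebPrim f t' - lebPrim f z) * G t')| := by ring_nf
        _ ≤ (A z - A t) * (V t' - V t) + (A t' - A z) * (V t' - V t) :=
            (abs_add_le _ _).trans (add_le_add h1 h2)
        _ = (A t' - A t) * (V t' - V t) := by ring
        _ ≤ _ := by gcongr
  refine ⟨_, by rw [extendReal_lebPrim hf]; exact hloc, ?_⟩
  rw [extendReal_lebPrim hf]
  simp [hQ, hG]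

theorem HasParts.linearComb_left {F₁ F₂ g : ℝ → ℝ} {I₁ I₂ : ℝ} (hF₁ : F₁ ∈ BC) (hF₂ : F₂ ∈ BC)
    (a b : ℝ) (h₁ : HasParts F₁ g I₁) (h₂ : HasParts F₂ g I₂) :
    HasParts (a • F₁ + b • F₂) g (a * I₁ + b * I₂) := by
  obtain ⟨-, hb₁, l₁, hl₁⟩ := hF₁
  obtain ⟨-, hb₂, l₂, hl₂⟩ := hF₂
  obtain ⟨J₁, h₁, rfl⟩ := h₁
  obtain ⟨J₂, h₂, rfl⟩ := h₂
  have h := extendReal_linearComb hb₁ hl₁ hb₂ hl₂ a b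
  refine ⟨_, h₁.linearComb h₂ (a := a) (b := b) fun z t t' => ?_, ?_⟩
  · simp only [h, Pi.add_apply, Pi.smul_apply, smul_eq_mul]
    ring
  · simp only [h, Pi.add_apply, Pi.smul_apply, smul_eq_mul]
    ring

theorem HasParts.linearComb_right {F g₁ g₂ : ℝ → ℝ} {I₁ I₂ : ℝ} (hg₁ : g₁ ∈ BV) (hg₂ : g₂ ∈ BV)
    (a b : ℝ) (h₁ : HasParts F g₁ I₁) (h₂ : HasParts F g₂ I₂) :
    HasParts F (a • g₁ + b • g₂) (a * I₁ + b * I₂) := by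
  obtain ⟨m₁, hb₁⟩ := exists_tendsto_atBot_of_mem_BV hg₁
  obtain ⟨m₂, hb₂⟩ := exists_tendsto_atBot_of_mem_BV hg₂
  obtain ⟨l₁, hl₁⟩ := exists_tendsto_atTop_of_mem_BV hg₁
  obtain ⟨l₂, hl₂⟩ := exists_tendsto_atTop_of_mem_BV hg₂
  obtain ⟨J₁, h₁, rfl⟩ := h₁
  obtain ⟨J₂, h₂, rfl⟩ := h₂
  have h := extendReal_linearComb hb₁ hl₁ hb₂ hl₂ a b
  refine ⟨_, h₁.linearComb h₂ (a := a) (b := b) fun z t t' => ?_, ?_⟩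
  · simp only [h, Pi.add_apply, Pi.smul_apply, smul_eq_mul]
    ring
  · simp only [h, Pi.add_apply, Pi.smul_apply, smul_eq_mul]
    ring

/-- The basic estimate. Writing `g(∞) = g(c) + (g(∞) - g(c))`, the integral differs from
`F(∞) g(c)` by `∫_c^∞ (F(∞) - F) dg - ∫_{-∞}^c F dg`. -/
theorem HasParts.abs_le {F g : ℝ → ℝ} {I S : ℝ} (h : HasParts F g I) (hF : F ∈ BC) (hg : g ∈ BV)
    (hS : ∀ a b : EReal, |extendReal F b - extendReal F a| ≤ S) (c : EReal) :
    |I| ≤ |extendReal F ⊤| * |extendReal g c| + S * variation g := by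
  obtain ⟨J, hJ, rfl⟩ := h
  set G := extendReal g with hG
  set l := extendReal F ⊤ with hl
  have hGV : BoundedVariationOn G univ := boundedVariationOn_extendReal hg
  have hS0 : 0 ≤ S := (abs_nonneg _).trans (hS 0 0)
  have hbot : extendReal F ⊥ = 0 := extendReal_bot hF.2.1
  -- `G = g₁ + g₂ - G c`, where `g₁` varies only below `c` and `g₂` only above
  let g₁ : EReal → ℝ := fun w => G (min w c)
  let g₂ : EReal → ℝ := fun w => G (max w c)
  have hV₁ : eVariationOn g₁ univ ≤ eVariationOn G (Iic c) :=
    eVariationOn.comp_le_of_monotoneOn G (fun w => min w c)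
      (fun _ _ _ _ h => min_le_min_right c h) fun w _ => min_le_right w c
  have hV₂ : eVariationOn g₂ univ ≤ eVariationOn G (Ici c) :=
    eVariationOn.comp_le_of_monotoneOn G (fun w => max w c)
      (fun _ _ _ _ h => max_le_max_right c h) fun w _ => le_max_right w c
  have hg₁ : BoundedVariationOn g₁ univ := ne_top_of_le_ne_top (hGV.mono (subset_univ _)) hV₁
  have hg₂ : BoundedVariationOn g₂ univ := ne_top_of_le_ne_top (hGV.mono (subset_univ _)) hV₂
  have hsum : (eVariationOn g₁ univ).toReal + (eVariationOn g₂ univ).toReal ≤ variation g := by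
    refine le_trans ?_ (toReal_eVariationOn_extendReal_le hg)
    rw [← ENNReal.toReal_add hg₁ hg₂]
    refine ENNReal.toReal_mono hGV ((add_le_add hV₁ hV₂).trans ?_)
    rw [← eVariationOn.union G isGreatest_Iic isLeast_Ici]
    exact eVariationOn.mono G (subset_univ _)
  have hdec : ∀ w, G w = g₁ w + g₂ w - G c := fun w => by
    rcases le_total w c with h | h <;> simp [g₁, g₂, h]
  have key : |J - l * (G ⊤ - G c)| ≤ S * variation g := by
    refine hJ.abs_sub_le fun N t z h0 hN ht => ?_
    have h2 : G ⊤ - G c = ∑ n ∈ Finset.range N, (g₂ (t (n + 1)) - g₂ (t n)) := by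
      rw [Finset.sum_range_sub fun n => g₂ (t n), h0, hN]
      simp [g₂]
    rw [h2, Finset.mul_sum, ← Finset.sum_sub_distrib]
    calc _ ≤ ∑ n ∈ Finset.range N, |extendReal F (z n) * (G (t (n + 1)) - G (t n)) -
            l * (g₂ (t (n + 1)) - g₂ (t n))| := Finset.abs_sum_le_sum_abs _ _
      _ ≤ ∑ n ∈ Finset.range N, (S * |g₁ (t (n + 1)) - g₁ (t n)| +
            S * |g₂ (t (n + 1)) - g₂ (t n)|) := by
          refine Finset.sum_le_sum fun n _ => ?_
          have e : extendReal F (z n) * (G (t (n + 1)) - G (t n)) -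
              l * (g₂ (t (n + 1)) - g₂ (t n)) =
              (extendReal F (z n) - extendReal F ⊥) * (g₁ (t (n + 1)) - g₁ (t n)) +
              (extendReal F (z n) - l) * (g₂ (t (n + 1)) - g₂ (t n)) := by
            rw [hdec, hdec (t n), hbot]
            ring
          rw [e]
          refine (abs_add_le _ _).trans ?_
          rw [abs_mul, abs_mul]
          gcongr
          · exact hS _ _
          · exact hS _ _
      _ ≤ S * (eVariationOn g₁ univ).toReal + S * (eVariationOn g₂ univ).toReal := by
          rw [Finset.sum_add_distrib, ← Finset.mul_sum, ← Finset.mul_sum]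
          gcongr
          · exact sum_abs_sub_le_variation hg₁ ht
          · exact sum_abs_sub_le_variation hg₂ ht
      _ ≤ _ := by rw [← mul_add]; gcongr
  calc |l * G ⊤ - J| = |l * G c - (J - l * (G ⊤ - G c))| := by ring_nf
    _ ≤ |l * G c| + |J - l * (G ⊤ - G c)| := abs_sub _ _
    _ ≤ _ := by rw [abs_mul]; gcongr

theorem abs_extendReal_le {F : ℝ → ℝ} (hF : F ∈ BC) {ε : ℝ} (h : ∀ x, |F x| ≤ ε) (w : EReal) :
    |extendReal F w| ≤ ε := by
  induction w with
  | bot =>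
    rw [extendReal_bot hF.2.1]
    exact le_of_tendsto hF.2.1.abs (Eventually.of_forall h)
  | coe x => simpa using h x
  | top =>
    obtain ⟨l, hl⟩ := hF.2.2
    rw [extendReal_top hl]
    exact le_of_tendsto hl.abs (Eventually.of_forall h)

theorem HasParts.abs_le_of_abs_le {F g : ℝ → ℝ} {I ε : ℝ} (h : HasParts F g I) (hF : F ∈ BC)
    (hg : g ∈ BV) (hε : ∀ x, |F x| ≤ ε) (x : ℝ) :
    |I| ≤ ε * (|g x| + 2 * variation g) := by
  have h' := abs_extendReal_le hF hε
  have := h.abs_le hF hg (S := 2 * ε) (fun a b => by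
    have := abs_sub (extendReal F b) (extendReal F a)
    linarith [h' a, h' b]) x
  rw [extendReal_coe] at this
  nlinarith [mul_le_mul_of_nonneg_right (h' ⊤) (abs_nonneg (g x))]

/-! ### Approximation by primitives of compactly supported functions -/

/-- Every `F ∈ B_C` is a uniform limit of primitives of continuous compactly supported functions:
make `F` constant near `±∞` and average over short intervals. -/
theorem exists_lebPrim_approx {F : ℝ → ℝ} (hF : F ∈ BC) {ε : ℝ} (hε : 0 < ε) :
    ∃ f : ℝ → ℝ, Continuous f ∧ HasCompactSupport f ∧ ∀ x : ℝ, |F x - lebPrim f x| ≤ ε := by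
  obtain ⟨hFc, hb, l, hl⟩ := hF
  obtain ⟨R, hR0, hRb, hRt⟩ : ∃ R > 0, (∀ x ≤ -R, |F x| < ε / 4) ∧ ∀ x ≥ R, |F x - l| < ε / 8 := by
    have h1 := (Metric.tendsto_nhds.1 hb) (ε / 4) (by positivity)
    have h2 := (Metric.tendsto_nhds.1 hl) (ε / 8) (by positivity)
    simp only [Real.dist_eq, sub_zero] at h1 h2
    obtain ⟨a, ha⟩ := eventually_atBot.1 h1
    obtain ⟨b, hb⟩ := eventually_atTop.1 h2
    refine ⟨max 1 (max (-a) b), by positivity, fun x hx => ha x ?_, fun x hx => hb x ?_⟩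
    · have : -a ≤ max 1 (max (-a) b) := (le_max_left _ _).trans (le_max_right _ _)
      linarith
    · exact ((le_max_right _ _).trans (le_max_right _ _)).trans hx
  -- the function `F₁` is `F` made constant outside `[-R, R]` and normalised to vanish at `-∞`
  let c : ℝ → ℝ := fun x => max (-R) (min x R)
  have hc : Continuous c := by fun_prop
  have hcm : ∀ x, c x ∈ Icc (-R) R := fun x =>
    ⟨le_max_left _ _, max_le (by linarith) (min_le_right _ _)⟩
  have hclip : ∀ x y, |c x - c y| ≤ |x - y| := by
    intro x y
    refine (abs_max_sub_max_le_max _ _ _ _).trans ?_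
    simp only [sub_self, abs_zero]
    refine max_le (abs_nonneg _) ((abs_min_sub_min_le_max _ _ _ _).trans ?_)
    simp
  let F₁ : ℝ → ℝ := fun x => F (c x) - F (-R)
  have hF₁c : Continuous F₁ := (hFc.comp hc).sub continuous_const
  have hF₁b : ∀ x ≤ -R, F₁ x = 0 := fun x hx => by
    have : c x = -R := max_eq_left ((min_le_left _ _).trans hx)
    simp [F₁, this]
  have hF₁t : ∀ x ≥ R, F₁ x = F R - F (-R) := fun x hx => by
    have : c x = R := by simp only [c, min_eq_right hx]; exact max_eq_right (by linarith)
    simp [F₁, this]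
  have hFF₁ : ∀ x, |F x - F₁ x| ≤ ε / 2 := by
    intro x
    have h0 := abs_lt.1 (hRb (-R) le_rfl)
    rcases le_total x (-R) with hx | hx
    · rw [hF₁b x hx, sub_zero]
      linarith [hRb x hx]
    rcases le_total x R with hx' | hx'
    · have : c x = x := by simp only [c, min_eq_left hx', max_eq_right hx]
      simp only [F₁, this]
      exact abs_le.2 ⟨by linarith, by linarith⟩
    · rw [hF₁t x hx']
      have h1 := abs_lt.1 (hRt x hx')
      have h2 := abs_lt.1 (hRt R le_rfl)
      exact abs_le.2 ⟨by linarith, by linarith⟩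
  obtain ⟨δ, hδ, hunif⟩ : ∃ δ > 0, ∀ x y, |x - y| < δ → |F₁ x - F₁ y| < ε / 2 := by
    obtain ⟨δ, hδ, h⟩ := Metric.uniformContinuousOn_iff.1
      (isCompact_Icc.uniformContinuousOn_of_continuous (hFc.continuousOn (s := Icc (-R) R)))
      (ε / 2) (by positivity)
    refine ⟨δ, hδ, fun x y hxy => ?_⟩
    have := h _ (hcm x) _ (hcm y) ((hclip x y).trans_lt hxy)
    simpa [F₁, Real.dist_eq] using this
  set d := δ / 2 with hd
  have hd0 : 0 < d := by positivity
  -- the derivative of the average `x ↦ d⁻¹ ∫_x^{x+d} F₁`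
  let f : ℝ → ℝ := fun x => d⁻¹ * (F₁ (x + d) - F₁ x)
  have hfc : Continuous f := by fun_prop
  have hfs : HasCompactSupport f := by
    refine HasCompactSupport.intro (isCompact_Icc (a := -R - d) (b := R)) fun x hx => ?_
    rw [mem_Icc, not_and_or, not_le, not_le] at hx
    rcases hx with hx | hx
    · simp [f, hF₁b (x + d) (by linarith), hF₁b x (by linarith)]
    · simp [f, hF₁t (x + d) (by linarith), hF₁t x (by linarith)]
  have hfi : Integrable f := hfc.integrable_of_hasCompactSupport hfs
  refine ⟨f, hfc, hfs, fun x => ?_⟩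
  have hprim : lebPrim f x = d⁻¹ * ∫ s in x..(x + d), F₁ s := by
    set m := min x (-R - d) with hm
    have h0 : ∫ s in Iic m, f s = 0 := setIntegral_eq_zero_of_forall_eq_zero fun s hs => by
      have : s ≤ -R - d := le_trans hs (min_le_right _ _)
      simp [f, hF₁b (s + d) (by linarith), hF₁b s (by linarith)]
    have h1 : ∫ s in m..(m + d), F₁ s = 0 := by
      refine (intervalIntegral.integral_congr fun s hs => ?_).trans intervalIntegral.integral_zero
      rw [uIcc_of_le (by linarith)] at hs
      have : m ≤ -R - d := min_le_right _ _
      exact hF₁b s (by linarith [hs.2])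
    have hi : ∀ a b, IntervalIntegrable F₁ volume a b := fun a b => hF₁c.intervalIntegrable a b
    have hi' : IntervalIntegrable (fun s => F₁ (s + d)) volume m x :=
      (hF₁c.comp (continuous_add_const d)).intervalIntegrable _ _
    rw [lebPrim_coe, ← sub_zero (∫ s in Iic x, f s), ← h0,
      intervalIntegral.integral_Iic_sub_Iic hfi.integrableOn hfi.integrableOn,
      intervalIntegral.integral_const_mul, intervalIntegral.integral_sub hi' (hi _ _),
      intervalIntegral.integral_comp_add_right (fun s => F₁ s),
      intervalIntegral.integral_interval_sub_interval_comm' (hi _ _) (hi _ _) (hi _ _), h1,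
      sub_zero]
  have havg : |lebPrim f x - F₁ x| ≤ ε / 2 := by
    have e : lebPrim f x - F₁ x = d⁻¹ * ∫ s in x..(x + d), (F₁ s - F₁ x) := by
      rw [intervalIntegral.integral_sub (hF₁c.intervalIntegrable _ _)
        intervalIntegrable_const, intervalIntegral.integral_const, hprim]
      simp only [add_sub_cancel_left, smul_eq_mul]
      field_simp
    have hn := intervalIntegral.norm_integral_le_of_norm_le_const (a := x) (b := x + d)
      (f := fun s => F₁ s - F₁ x) (C := ε / 2) fun s hs => by
        rw [uIoc_of_le (by linarith)] at hs
        refine (hunif s x ?_).le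
        rw [abs_of_pos (by linarith [hs.1])]
        linarith [hs.2]
    rw [add_sub_cancel_left, abs_of_pos hd0, Real.norm_eq_abs] at hn
    rw [e, abs_mul, abs_of_pos (inv_pos.2 hd0), inv_mul_le_iff₀ hd0]
    linarith
  have := abs_sub_le (F x) (F₁ x) (lebPrim f x)
  rw [abs_sub_comm (F₁ x)] at this
  linarith [hFF₁ x]

theorem exists_hasParts {F g : ℝ → ℝ} (hF : F ∈ BC) (hg : g ∈ BV) : ∃ I, HasParts F g I := by
  obtain ⟨l, hl⟩ := hF.2.2
  obtain ⟨J, hJ⟩ := exists_hasHSIntegral_of_approx (F := extendReal F)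
    (boundedVariationOn_extendReal hg) fun ε hε => by
      obtain ⟨f, hfc, hfs, hf⟩ := exists_lebPrim_approx hF hε
      have hfi : Integrable f := hfc.integrable_of_hasCompactSupport hfs
      obtain ⟨J, hJ, -⟩ := hasParts_lebPrim hfi hg
      obtain ⟨-, h0, l', hl'⟩ := lebPrim_mem_BC hfi
      exact ⟨_, J, hJ, abs_extendReal_sub_le hF.2.1 hl h0 hl' hf⟩
  exact ⟨_, J, hJ, rfl⟩

/-! ### Distributions with a continuous primitive -/

theorem IsPrimitive.apply {F : ℝ → ℝ} {f : Distr} (h : IsPrimitive F f) (φ : TestFn) :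
    f φ = -∫ t, deriv φ t * F t := by
  rw [← h.2]
  change -(regularDist F (∂_{(1 : ℝ)} φ)) = _
  rw [regularDist_apply h.1.1]
  rfl

theorem isPrimitive_of_apply {F : ℝ → ℝ} {f : Distr} (hF : F ∈ BC)
    (h : ∀ φ : TestFn, f φ = -∫ t, deriv φ t * F t) : IsPrimitive F f := by
  refine ⟨hF, ?_⟩
  ext φ
  rw [h, (show IsPrimitive F (∂_{(1 : ℝ)} (regularDist F)) from ⟨hF, rfl⟩).apply]

theorem integrable_deriv_mul (φ : TestFn) {F : ℝ → ℝ} (hF : Continuous F) :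
    Integrable fun t => deriv φ t * F t := by
  have h : Continuous (deriv φ) := φ.contDiff.continuous_deriv (by simp)
  exact (h.mul hF).integrable_of_hasCompactSupport φ.hasCompactSupport.deriv.mul_right

/-- Local du Bois-Reymond lemma: a continuous function whose distributional derivative vanishes on
a ball is constant on the concentric ball of half the radius. For a test function `ψ` supported in
the small ball, `b ↦ ∫ H ψ(· - b)` has zero derivative for small `b`, so `H(· + a) - H` is
orthogonal to all such `ψ`. -/
theorem eq_center_of_integral_deriv_mul_eq_zero {H : ℝ → ℝ} (hH : Continuous H) {z r : ℝ}
    (h : ∀ φ : TestFn, tsupport φ ⊆ Metric.ball z (2 * r) → ∫ t, deriv φ t * H t = 0) {x : ℝ}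
    (hx : x ∈ Metric.ball z r) : H x = H z := by
  have hr : 0 < r := Metric.pos_of_mem_ball hx
  set a := x - z with ha
  have har : |a| < r := by simpa [Real.dist_eq] using hx
  have hloc : LocallyIntegrable H := hH.locallyIntegrable
  have key : ∀ ψ : ℝ → ℝ, ContDiff ℝ ∞ ψ → HasCompactSupport ψ → tsupport ψ ⊆ Metric.ball z r →
      ∫ t, ψ t • (H (t + a) - H t) = 0 := by
    intro ψ hψ hψc hψs
    -- `b ↦ ∫ H ψ(· - b)` is the convolution of `H` with `χ`
    let χ : ℝ → ℝ := fun s => ψ (-s)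
    have hχ : ContDiff ℝ ∞ χ := hψ.comp contDiff_neg
    have hχc : HasCompactSupport χ := hψc.comp_homeomorph (Homeomorph.neg ℝ)
    have hderiv : ∀ b, HasDerivAt (H ⋆[ContinuousLinearMap.mul ℝ ℝ, volume] χ)
        ((H ⋆[ContinuousLinearMap.mul ℝ ℝ, volume] deriv χ) b) b := fun b =>
      hχc.hasDerivAt_convolution_right _ hloc (hχ.of_le (by simp)) b
    have hzero : ∀ b ∈ Metric.ball (0 : ℝ) r,
        (H ⋆[ContinuousLinearMap.mul ℝ ℝ, volume] deriv χ) b = 0 := by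
      intro b hb
      have hb' : |b| < r := by simpa using hb
      let φ : TestFn := ⟨fun t => ψ (t - b), hψ.comp (contDiff_id.sub contDiff_const),
        hψc.comp_homeomorph (Homeomorph.subRight b), fun _ _ => trivial⟩
      have hφs : tsupport φ ⊆ Metric.ball z (2 * r) := by
        intro t ht
        have : t - b ∈ tsupport ψ :=
          tsupport_comp_subset_preimage ψ (f := fun t => t - b) (by fun_prop) ht
        have := hψs this
        rw [Metric.mem_ball, Real.dist_eq, abs_lt] at this ⊢
        rw [abs_lt] at hb'
        constructor <;> linarith
      have h0 := h φ hφs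
      rw [convolution_def, ← neg_eq_zero, ← integral_neg, ← h0]
      refine integral_congr_ae (Eventually.of_forall fun t => ?_)
      have e1 : deriv χ (b - t) = -deriv ψ (t - b) := by
        simp only [χ]
        rw [deriv_comp_neg, neg_sub]
      have e2 : deriv φ t = deriv ψ (t - b) := deriv_comp_sub_const ψ b t
      simp only [ContinuousLinearMap.mul_apply', e1, e2]
      ring
    have hconst := Metric.isOpen_ball.is_const_of_deriv_eq_zero
      (convex_ball (0 : ℝ) r).isPreconnected
      (fun b _ => (hderiv b).differentiableAt.differentiableWithinAt)
      (fun b hb => (hderiv b).deriv.trans (hzero b hb))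
      (show a ∈ Metric.ball (0 : ℝ) r by simpa using har) (Metric.mem_ball_self hr)
    simp only [convolution_def, ContinuousLinearMap.mul_apply', χ, neg_sub, sub_zero] at hconst
    have e : ∫ t, H t * ψ (t - a) = ∫ t, H (t + a) * ψ t := by
      rw [← integral_add_right_eq_self _ a]
      simp
    rw [e] at hconst
    have i1 : Integrable fun t => H (t + a) * ψ t :=
      ((hH.comp (continuous_add_const a)).mul hψ.continuous).integrable_of_hasCompactSupport
        hψc.mul_left
    have i2 : Integrable fun t => H t * ψ t :=
      (hH.mul hψ.continuous).integrable_of_hasCompactSupport hψc.mul_left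
    rw [← sub_eq_zero, ← integral_sub i1 i2] at hconst
    rw [← hconst]
    refine integral_congr_ae (Eventually.of_forall fun t => ?_)
    simp only [smul_eq_mul]
    ring
  have hc : Continuous fun t => H (t + a) - H t := by fun_prop
  have hae := Metric.isOpen_ball.ae_eq_zero_of_integral_contDiff_smul_eq_zero
    (hc.locallyIntegrable.locallyIntegrableOn _) key
  have := Measure.eqOn_open_of_ae_eq (μ := volume) (f := fun t => H (t + a) - H t) (g := 0)
    ((ae_restrict_iff' measurableSet_ball).2 hae) Metric.isOpen_ball hc.continuousOn
    continuousOn_const (Metric.mem_ball_self hr)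
  have h' : H (z + a) - H z = 0 := this
  rwa [ha, add_sub_cancel, sub_eq_zero] at h'

theorem IsPrimitive.unique {F G : ℝ → ℝ} {f : Distr} (hF : IsPrimitive F f)
    (hG : IsPrimitive G f) : F = G := by
  have hc : Continuous (F - G) := hF.1.1.sub hG.1.1
  have h0 : ∀ φ : TestFn, ∫ t, deriv φ t * (F - G) t = 0 := fun φ => by
    have := hF.apply φ
    rw [hG.apply φ, neg_inj] at this
    simp only [Pi.sub_apply, mul_sub]
    rw [integral_sub (integrable_deriv_mul φ hF.1.1) (integrable_deriv_mul φ hG.1.1), this,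
      sub_self]
  have hconst : ∀ x, (F - G) x = (F - G) 0 := fun x =>
    eq_center_of_integral_deriv_mul_eq_zero hc (r := |x| + 1) (fun φ _ => h0 φ) (by simp)
  have hlim : Tendsto (F - G) atBot (𝓝 0) := by simpa using! hF.1.2.1.sub hG.1.2.1
  have h00 : (F - G) 0 = 0 :=
    tendsto_nhds_unique (tendsto_const_nhds.congr fun x => (hconst x).symm) hlim
  ext x
  have := hconst x
  rw [h00, Pi.sub_apply] at this
  linarith

theorem isPrimitive_primitive {f : Distr} (hf : f ∈ AC) : IsPrimitive (primitive f) f := by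
  have h : ∃ F, IsPrimitive F f := hf
  rw [primitive, dif_pos h]
  exact h.choose_spec

theorem primitive_mem_BC {f : Distr} (hf : f ∈ AC) : primitive f ∈ BC :=
  (isPrimitive_primitive hf).1

theorem IsPrimitive.primitive_eq {F : ℝ → ℝ} {f : Distr} (h : IsPrimitive F f) :
    primitive f = F :=
  (isPrimitive_primitive ⟨F, h⟩).unique h

/-- The primitive of `f(x - ·)` in `B_C` is `F(∞) - F(x - ·)`; the constant makes it vanish at
`-∞`. -/
theorem IsPrimitive.reflect {F : ℝ → ℝ} {f : Distr} (h : IsPrimitive F f) (x : ℝ) :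
    IsPrimitive (fun t => extendReal F ⊤ - F (x - t)) (reflectDist x f) := by
  obtain ⟨l, hl⟩ := h.1.2.2
  rw [extendReal_top hl]
  refine isPrimitive_of_apply ⟨continuous_const.sub (h.1.1.comp (continuous_const.sub
    continuous_id)), ?_, l, ?_⟩ fun φ => ?_
  · have : Tendsto (fun t : ℝ => x - t) atBot atTop := by
      simpa [sub_eq_add_neg] using tendsto_atTop_add_const_left atBot x tendsto_neg_atBot_atTop
    simpa using! (tendsto_const_nhds (x := l)).sub (hl.comp this)
  · have : Tendsto (fun t : ℝ => x - t) atTop atBot := by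
      simpa [sub_eq_add_neg] using tendsto_atBot_add_const_left atTop x tendsto_neg_atTop_atBot
    simpa using! (tendsto_const_nhds (x := l)).sub (h.1.2.1.comp this)
  · rw [reflectDist_apply, h.apply, ← integral_sub_left_eq_self _ volume x]
    have e1 : ∀ t, deriv (reflectTest x φ) (x - t) = -deriv φ t := fun t => by
      have : (reflectTest x φ : ℝ → ℝ) = fun s => φ (x - s) := rfl
      rw [this, deriv_comp_const_sub, sub_sub_cancel]
    have e2 : ∫ t, deriv φ t = 0 :=
      integral_eq_zero_of_hasDerivAt_of_integrable
        (fun t => (φ.contDiff.differentiable (by simp) t).hasDerivAt)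
        (by simpa using integrable_deriv_mul φ (F := fun _ => 1) continuous_const)
        (φ.continuous.integrable_of_hasCompactSupport φ.hasCompactSupport)
    have e3 : ∫ t, deriv φ t * (l - F (x - t)) =
        (∫ t, deriv φ t * l) - ∫ t, deriv φ t * F (x - t) := by
      rw [← integral_sub (integrable_deriv_mul φ continuous_const)
        (integrable_deriv_mul φ (F := fun t => F (x - t)) (h.1.1.comp (continuous_const.sub
          continuous_id)))]
      simp only [mul_sub]
    rw [e3, integral_mul_const, e2, zero_mul, zero_sub]
    simp only [e1, neg_mul, integral_neg]

theorem reflectDist_mem_AC {f : Distr} (hf : f ∈ AC) (x : ℝ) : reflectDist x f ∈ AC :=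
  ⟨_, (isPrimitive_primitive hf).reflect x⟩

theorem primitive_reflectDist {f : Distr} (hf : f ∈ AC) (x : ℝ) :
    primitive (reflectDist x f) = fun t => extendReal (primitive f) ⊤ - primitive f (x - t) :=
  ((isPrimitive_primitive hf).reflect x).primitive_eq

/-- A translation is a composition of two reflections. -/
theorem translateDist_eq_reflectDist (z : ℝ) (f : Distr) :
    translateDist z f = reflectDist z (reflectDist 0 f) := by
  ext φ
  rw [translateDist_apply, reflectDist_apply, reflectDist_apply]
  congr 1
  ext s
  simp [add_comm]

theorem translateDist_mem_AC {f : Distr} (hf : f ∈ AC) (z : ℝ) : translateDist z f ∈ AC := by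
  rw [translateDist_eq_reflectDist]
  exact reflectDist_mem_AC (reflectDist_mem_AC hf 0) z

theorem reflectDist_translateDist (x z : ℝ) (f : Distr) :
    reflectDist x (translateDist z f) = reflectDist (x - z) f := by
  ext φ
  rw [reflectDist_apply, translateDist_apply, reflectDist_apply]
  congr 1
  ext s
  simp [sub_sub, add_comm]

theorem primitive_linearComb {f₁ f₂ : Distr} (h₁ : f₁ ∈ AC) (h₂ : f₂ ∈ AC) (a b : ℝ) :
    primitive (a • f₁ + b • f₂) = a • primitive f₁ + b • primitive f₂ := by
  have H₁ := isPrimitive_primitive h₁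
  have H₂ := isPrimitive_primitive h₂
  refine IsPrimitive.primitive_eq ⟨BC.add_mem (BC.smul_mem a H₁.1) (BC.smul_mem b H₂.1), ?_⟩
  rw [regularDist_add (H₁.1.1.const_smul a) (H₂.1.1.const_smul b), regularDist_smul a H₁.1.1,
    regularDist_smul b H₂.1.1, LineDeriv.lineDerivOp_add, LineDeriv.lineDerivOp_smul,
    LineDeriv.lineDerivOp_smul, H₁.2, H₂.2]

/-- Off the support of `f ∈ A_C`, the primitive is locally constant. -/
theorem primitive_eventually_eq {f : Distr} (hf : f ∈ AC) {z : ℝ}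
    (hz : z ∉ Distribution.dsupport f) : ∀ᶠ x in 𝓝 z, primitive f x = primitive f z := by
  obtain ⟨s, hs, hso, hzs⟩ := (Distribution.notMem_dsupport_iff z).1 hz
  obtain ⟨r, hr, hrs⟩ := Metric.isOpen_iff.1 hso z hzs
  filter_upwards [Metric.ball_mem_nhds z (half_pos hr)] with x hx
  refine eq_center_of_integral_deriv_mul_eq_zero (primitive_mem_BC hf).1 (fun φ hφ => ?_) hx
  have := hs φ (hφ.trans (by rwa [mul_div_cancel₀ _ two_ne_zero]))
  rwa [(isPrimitive_primitive hf).apply, neg_eq_zero] at this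

/-! ### Existence of the integral and approximation by Lebesgue integrals -/

theorem existsUnique_hasMulIntegral {f : Distr} (hf : f ∈ AC) {g : ℝ → ℝ} (hg : g ∈ BV) :
    ∃! I, HasMulIntegral f g I := by
  obtain ⟨I, hI⟩ := exists_hasParts (primitive_mem_BC hf) hg
  exact ⟨I, hI, fun J hJ => HasParts.unique hJ hI⟩

theorem mulIntegral_eq {f : Distr} {g : ℝ → ℝ} {I : ℝ} (h : HasMulIntegral f g I) :
    mulIntegral f g = I := by
  have h' : ∃ I, HasMulIntegral f g I := ⟨I, h⟩
  rw [mulIntegral, dif_pos h']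
  exact HasParts.unique h'.choose_spec h

theorem hasParts_mulIntegral {f : Distr} (hf : f ∈ AC) {g : ℝ → ℝ} (hg : g ∈ BV) :
    HasParts (primitive f) g (mulIntegral f g) := by
  obtain ⟨I, hI, -⟩ := existsUnique_hasMulIntegral hf hg
  rw [mulIntegral_eq hI]
  exact hI

theorem acIntegral_bot_top {f : Distr} (hf : f ∈ AC) :
    acIntegral f ⊥ ⊤ = extendReal (primitive f) ⊤ := by
  rw [acIntegral, extendReal_bot (primitive_mem_BC hf).2.1, sub_zero]

theorem lebPrim_comp_const_sub {f : ℝ → ℝ} (hf : Integrable f) (x t : ℝ) :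
    lebPrim (fun s => f (x - s)) t = (∫ s, f s) - lebPrim f ((x - t : ℝ) : EReal) := by
  rw [lebPrim_coe, lebPrim_coe, ← intervalIntegral.integral_Iic_add_Ioi (b := x - t)
    hf.integrableOn hf.integrableOn, add_sub_cancel_left, ← integral_Ici_eq_integral_Ioi,
    ← integral_indicator measurableSet_Iic, ← integral_indicator measurableSet_Ici,
    ← integral_sub_left_eq_self _ volume x]
  refine integral_congr_ae (Eventually.of_forall fun s => ?_)
  simp only [indicator, mem_Iic, mem_Ici, sub_sub_cancel]
  have : x - s ≤ t ↔ x - t ≤ s := sub_le_comm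
  simp only [this]

/-- Every `f ∈ A_C` is a limit of continuous compactly supported functions `u n`, in such a way
that integrals and convolutions against any `g ∈ BV` are limits of Lebesgue integrals. -/
theorem exists_approx_seq {f : Distr} (hf : f ∈ AC) : ∃ u : ℕ → ℝ → ℝ,
    (∀ n, Continuous (u n)) ∧ (∀ n, HasCompactSupport (u n)) ∧
    Tendsto (fun n => ∫ y, u n y) atTop (𝓝 (acIntegral f ⊥ ⊤)) ∧
    ∀ g ∈ BV, Tendsto (fun n => ∫ y, u n y * g y) atTop (𝓝 (mulIntegral f g)) ∧
      TendstoUniformly (fun n x => ∫ y, u n (x - y) * g y) (conv f g) atTop := by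
  have hF := primitive_mem_BC hf
  set F := primitive f with hFdef
  let e : ℕ → ℝ := fun n => 1 / ((n : ℝ) + 1)
  have he : ∀ n, 0 < e n := fun n => by positivity
  have he0 : Tendsto e atTop (𝓝 0) := tendsto_one_div_add_atTop_nhds_zero_nat
  choose u huc hus hu using fun n => exists_lebPrim_approx hF (he n)
  have hui : ∀ n, Integrable (u n) := fun n => (huc n).integrable_of_hasCompactSupport (hus n)
  have htop : ∀ n, |extendReal F ⊤ - ∫ y, u n y| ≤ e n := fun n => by
    obtain ⟨l, hl⟩ := hF.2.2
    obtain ⟨-, h0, l', hl'⟩ := lebPrim_mem_BC (hui n)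
    have := abs_extendReal_sub_le hF.2.1 hl h0 hl' (hu n) ⊤
    rwa [extendReal_lebPrim (hui n), lebPrim_top] at this
  have hdiff : ∀ {F₁ F₂ g : ℝ → ℝ} {I₁ I₂ c : ℝ}, F₁ ∈ BC → F₂ ∈ BC → g ∈ BV →
      HasParts F₁ g I₁ → HasParts F₂ g I₂ → (∀ x, |F₁ x - F₂ x| ≤ c) →
      |I₁ - I₂| ≤ c * (|g 0| + 2 * variation g) := by
    intro F₁ F₂ g I₁ I₂ c h₁ h₂ hg p₁ p₂ hc
    have := (p₁.linearComb_left h₁ h₂ 1 (-1) p₂).abs_le_of_abs_le (ε := c)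
      (BC.add_mem (BC.smul_mem _ h₁) (BC.smul_mem _ h₂)) hg (fun x => by
        simpa [sub_eq_add_neg] using hc x) 0
    simpa [sub_eq_add_neg] using this
  refine ⟨u, huc, hus, ?_, fun g hg => ⟨?_, ?_⟩⟩
  · rw [acIntegral_bot_top hf, tendsto_iff_dist_tendsto_zero]
    refine squeeze_zero (fun _ => dist_nonneg) (fun n => ?_) he0
    rw [dist_comm]
    exact htop n
  · rw [tendsto_iff_dist_tendsto_zero]
    refine squeeze_zero (fun _ => dist_nonneg) (fun n => ?_)
      (by simpa using he0.mul_const (|g 0| + 2 * variation g))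
    rw [dist_comm]
    exact hdiff hF (lebPrim_mem_BC (hui n)) hg (hasParts_mulIntegral hf hg)
      (hasParts_lebPrim (hui n) hg) (hu n)
  · rw [Metric.tendstoUniformly_iff]
    intro ε hε
    have h0 : Tendsto (fun n => 2 * e n * (|g 0| + 2 * variation g)) atTop (𝓝 0) := by
      simpa using (he0.const_mul 2).mul_const (|g 0| + 2 * variation g)
    filter_upwards [h0.eventually (gt_mem_nhds hε)] with n hn x
    refine lt_of_le_of_lt ?_ hn
    have hr := hasParts_mulIntegral (reflectDist_mem_AC hf x) hg
    have hux : Integrable fun s => u n (x - s) := (hui n).comp_sub_left x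
    refine hdiff (primitive_mem_BC (reflectDist_mem_AC hf x)) (lebPrim_mem_BC hux) hg hr
      (hasParts_lebPrim hux hg) fun t => ?_
    -- the primitives of the reflections are `F(∞) - F(x - ·)` and `∫ u n - U n (x - ·)`, so two
    -- errors of size `e n` occur, uniformly in `x`
    rw [primitive_reflectDist hf, lebPrim_comp_const_sub (hui n)]
    have h1 := abs_le.1 (htop n)
    have h2 := abs_le.1 (hu n (x - t))
    exact abs_le.2 ⟨by linarith, by linarith⟩

/-! ### Commutativity, estimates and limits -/

theorem comp_const_sub_mem_BV {g : ℝ → ℝ} (hg : g ∈ BV) (x : ℝ) : (fun y => g (x - y)) ∈ BV :=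
  comp_antitone_mem_BV hg fun _ _ h => sub_le_sub_left h x

theorem comp_sub_const_mem_BV {g : ℝ → ℝ} (hg : g ∈ BV) (x : ℝ) : (fun y => g (y - x)) ∈ BV :=
  comp_monotone_mem_BV hg fun _ _ h => sub_le_sub_right h x

theorem integral_comp_const_sub_mul (u g : ℝ → ℝ) (x : ℝ) :
    ∫ y, u (x - y) * g y = ∫ y, u y * g (x - y) := by
  rw [← integral_sub_left_eq_self (fun y => u y * g (x - y)) volume x]
  simp

/-- Commutativity: `∫ (f ∘ r_x) g = ∫ f (g ∘ r_x)`, by approximation. -/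
theorem conv_eq_mulIntegral {f : Distr} (hf : f ∈ AC) {g : ℝ → ℝ} (hg : g ∈ BV) (x : ℝ) :
    conv f g x = mulIntegral f fun y => g (x - y) := by
  obtain ⟨u, -, -, -, hu⟩ := exists_approx_seq hf
  refine tendsto_nhds_unique ((hu g hg).2.tendsto_at x) ?_
  simp only [integral_comp_const_sub_mul]
  exact (hu _ (comp_const_sub_mem_BV hg x)).1

theorem variation_nonneg (g : ℝ → ℝ) : 0 ≤ variation g := ENNReal.toReal_nonneg

theorem exists_abs_primitive_le {f : Distr} (hf : f ∈ AC) :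
    ∃ M, ∀ w, |extendReal (primitive f) w| ≤ M := by
  obtain ⟨u, huc, hus, hu⟩ := exists_lebPrim_approx (primitive_mem_BC hf) one_pos
  have hui : Integrable u := huc.integrable_of_hasCompactSupport hus
  refine ⟨1 + ∫ s, |u s|, fun w => abs_extendReal_le (primitive_mem_BC hf) (fun x => ?_) w⟩
  have h1 : |lebPrim u x| ≤ ∫ s, |u s| :=
    (norm_integral_le_integral_norm _).trans
      (setIntegral_le_integral hui.norm (Eventually.of_forall fun s => norm_nonneg _))
  have h2 := abs_sub_abs_le_abs_sub (primitive f x) (lebPrim u x)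
  linarith [hu x]

theorem bddAbove_acIntegral {f : Distr} (hf : f ∈ AC) :
    BddAbove {r | ∃ a b : EReal, a ≤ b ∧ r = |acIntegral f a b|} := by
  obtain ⟨M, hM⟩ := exists_abs_primitive_le hf
  refine ⟨M + M, ?_⟩
  rintro _ ⟨a, b, -, rfl⟩
  exact (abs_sub _ _).trans (add_le_add (hM b) (hM a))

theorem abs_acIntegral_le {f : Distr} (hf : f ∈ AC) (a b : EReal) :
    |acIntegral f a b| ≤ alexNorm f := by
  rcases le_total a b with h | h
  · exact le_csSup (bddAbove_acIntegral hf) ⟨a, b, h, rfl⟩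
  · rw [acIntegral, abs_sub_comm]
    exact le_csSup (bddAbove_acIntegral hf) ⟨b, a, h, rfl⟩

theorem alexNorm_nonneg {f : Distr} (hf : f ∈ AC) : 0 ≤ alexNorm f :=
  (abs_nonneg _).trans (abs_acIntegral_le hf 0 0)

theorem variation_comp_const_sub_le {g : ℝ → ℝ} (hg : g ∈ BV) (x : ℝ) :
    variation (fun y => g (x - y)) ≤ variation g :=
  ENNReal.toReal_mono hg (eVariationOn.comp_le_of_antitoneOn g (fun y => x - y)
    (fun _ _ _ _ h => sub_le_sub_left h x) (mapsTo_univ _ _))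

theorem abs_conv_le_point {f : Distr} (hf : f ∈ AC) {g : ℝ → ℝ} (hg : g ∈ BV) (x c : ℝ) :
    |conv f g x| ≤ |acIntegral f ⊥ ⊤| * |g c| + alexNorm f * variation g := by
  have h := (hasParts_mulIntegral hf (comp_const_sub_mem_BV hg x)).abs_le (primitive_mem_BC hf)
    (comp_const_sub_mem_BV hg x) (abs_acIntegral_le hf) ((x - c : ℝ) : EReal)
  rw [extendReal_coe, sub_sub_cancel, ← acIntegral_bot_top hf, ← conv_eq_mulIntegral hf hg] at h
  refine h.trans ?_
  have := alexNorm_nonneg hf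
  gcongr
  exact variation_comp_const_sub_le hg x

theorem abs_conv_le {f : Distr} (hf : f ∈ AC) {g : ℝ → ℝ} (hg : g ∈ BV) (x : ℝ) :
    |conv f g x| ≤ |acIntegral f ⊥ ⊤| * (⨅ y, |g y|) + alexNorm f * variation g := by
  rw [Real.mul_iInf_of_nonneg (abs_nonneg _), ← sub_le_iff_le_add]
  exact le_ciInf fun c => by linarith [abs_conv_le_point hf hg x c]

theorem bddAbove_abs_conv {f : Distr} (hf : f ∈ AC) {g : ℝ → ℝ} (hg : g ∈ BV) :
    BddAbove (range fun x => |conv f g x|) :=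
  ⟨_, by rintro _ ⟨x, rfl⟩; exact abs_conv_le hf hg x⟩

theorem iInf_abs_le_abs_limUnder {g : ℝ → ℝ} (hg : g ∈ BV) :
    ⨅ y, |g y| ≤ |limUnder atBot g| := by
  obtain ⟨l, hl⟩ := exists_tendsto_atBot_of_mem_BV hg
  rw [hl.limUnder_eq]
  exact ge_of_tendsto hl.abs (Eventually.of_forall fun x =>
    ciInf_le ⟨0, by rintro _ ⟨y, rfl⟩; exact abs_nonneg _⟩ x)

theorem estimate_le_alexNorm_mul_bvNorm {f : Distr} (hf : f ∈ AC) {g : ℝ → ℝ} (hg : g ∈ BV) :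
    |acIntegral f ⊥ ⊤| * (⨅ x, |g x|) + alexNorm f * variation g ≤ alexNorm f * bvNorm g := by
  have := alexNorm_nonneg hf
  rw [bvNorm, mul_add]
  gcongr
  · exact Real.iInf_nonneg fun x => abs_nonneg _
  · exact abs_acIntegral_le hf _ _
  · exact iInf_abs_le_abs_limUnder hg

theorem supNorm_conv_le {f : Distr} (hf : f ∈ AC) {g : ℝ → ℝ} (hg : g ∈ BV) :
    supNorm (conv f g) ≤ |acIntegral f ⊥ ⊤| * (⨅ x, |g x|) + alexNorm f * variation g :=
  ciSup_le (abs_conv_le hf hg)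

theorem locallyIntegrable_of_mem_BV {g : ℝ → ℝ} (hg : g ∈ BV) : LocallyIntegrable g :=
  (memLp_top_of_bound (measurable_of_mem_BV hg).aestronglyMeasurable (|g 0| + variation g)
    (Eventually.of_forall fun x => abs_le_of_mem_BV hg x)).locallyIntegrable le_top

theorem continuous_integral_comp_sub_mul {u g : ℝ → ℝ} (hu : Continuous u)
    (hus : HasCompactSupport u) (hg : g ∈ BV) : Continuous fun x => ∫ y, u (x - y) * g y := by
  have := hus.continuous_convolution_right (ContinuousLinearMap.mul ℝ ℝ) (μ := volume)
    (locallyIntegrable_of_mem_BV hg) hu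
  refine this.congr fun x => ?_
  simp only [convolution_def, ContinuousLinearMap.mul_apply', mul_comm]

theorem continuous_conv {f : Distr} (hf : f ∈ AC) {g : ℝ → ℝ} (hg : g ∈ BV) :
    Continuous (conv f g) := by
  obtain ⟨u, huc, hus, -, hu⟩ := exists_approx_seq hf
  exact (hu g hg).2.continuous
    (Frequently.of_forall fun n => continuous_integral_comp_sub_mul (huc n) (hus n) hg)

theorem tendsto_integral_comp_sub_mul {u g : ℝ → ℝ} (hu : Integrable u) (hg : g ∈ BV)
    {L : Filter ℝ} [L.IsCountablyGenerated] {l : ℝ}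
    (h : ∀ y, Tendsto (fun x => g (x - y)) L (𝓝 l)) :
    Tendsto (fun x => ∫ y, u (x - y) * g y) L (𝓝 (l * ∫ y, u y)) := by
  simp only [integral_comp_const_sub_mul]
  rw [mul_comm, ← integral_mul_const]
  refine tendsto_integral_filter_of_dominated_convergence
    (fun y => |u y| * (|g 0| + variation g)) (Eventually.of_forall fun x =>
      (integrable_mul_of_mem_BV hu (comp_const_sub_mem_BV hg x)).aestronglyMeasurable)
    (Eventually.of_forall fun x => Eventually.of_forall fun y => ?_) (hu.abs.mul_const _)
    (Eventually.of_forall fun y => (h y).const_mul _)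
  rw [norm_mul, Real.norm_eq_abs, Real.norm_eq_abs]
  gcongr
  exact abs_le_of_mem_BV hg _

theorem tendsto_conv {f : Distr} (hf : f ∈ AC) {g : ℝ → ℝ} (hg : g ∈ BV)
    {L : Filter ℝ} [L.IsCountablyGenerated] {l : ℝ}
    (h : ∀ y, Tendsto (fun x => g (x - y)) L (𝓝 l)) :
    Tendsto (conv f g) L (𝓝 (l * acIntegral f ⊥ ⊤)) := by
  obtain ⟨u, huc, hus, hu0, hu⟩ := exists_approx_seq hf
  exact (hu g hg).2.tendsto_of_eventually_tendsto
    (Eventually.of_forall fun n => tendsto_integral_comp_sub_mul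
      ((huc n).integrable_of_hasCompactSupport (hus n)) hg h) (hu0.const_mul l)

theorem tendsto_conv_atTop {f : Distr} (hf : f ∈ AC) {g : ℝ → ℝ} (hg : g ∈ BV) {l : ℝ}
    (h : Tendsto g atTop (𝓝 l)) : Tendsto (conv f g) atTop (𝓝 (l * acIntegral f ⊥ ⊤)) :=
  tendsto_conv hf hg fun y => h.comp (by
    simpa [sub_eq_add_neg] using tendsto_atTop_add_const_right atTop (-y) tendsto_id)

theorem tendsto_conv_atBot {f : Distr} (hf : f ∈ AC) {g : ℝ → ℝ} (hg : g ∈ BV) {l : ℝ}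
    (h : Tendsto g atBot (𝓝 l)) : Tendsto (conv f g) atBot (𝓝 (l * acIntegral f ⊥ ⊤)) :=
  tendsto_conv hf hg fun y => h.comp (by
    simpa [sub_eq_add_neg] using tendsto_atBot_add_const_right atBot (-y) tendsto_id)

theorem conv_mem_C0bar {f : Distr} (hf : f ∈ AC) {g : ℝ → ℝ} (hg : g ∈ BV) :
    conv f g ∈ C0bar := by
  obtain ⟨a, ha⟩ := exists_tendsto_atBot_of_mem_BV hg
  obtain ⟨b, hb⟩ := exists_tendsto_atTop_of_mem_BV hg
  exact ⟨continuous_conv hf hg, ⟨_, tendsto_conv_atBot hf hg ha⟩, ⟨_, tendsto_conv_atTop hf hg hb⟩⟩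

/-! ### Associativity -/

theorem integrable_comp_sub_mul {g h : ℝ → ℝ} (hg : g ∈ BV) (hh : Integrable h) (x : ℝ) :
    Integrable fun y => g (x - y) * h y := by
  simpa only [mul_comm] using integrable_mul_of_mem_BV hh (comp_const_sub_mem_BV hg x)

theorem fnConv_mem_BV {g h : ℝ → ℝ} (hg : g ∈ BV) (hh : Integrable h) : fnConv g h ∈ BV := by
  refine ne_top_of_le_ne_top (ENNReal.ofReal_ne_top (r := variation g * ∫ y, |h y|))
    (iSup_le fun ⟨N, t, ht, _⟩ => ?_)
  simp only [edist_dist, Real.dist_eq]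
  rw [← ENNReal.ofReal_sum_of_nonneg fun _ _ => abs_nonneg _]
  refine ENNReal.ofReal_le_ofReal ?_
  have hi : ∀ n, Integrable fun y => |g (t (n + 1) - y) - g (t n - y)| * |h y| := fun n => by
    have := ((integrable_comp_sub_mul hg hh (t (n + 1))).sub
      (integrable_comp_sub_mul hg hh (t n))).abs
    simpa only [Pi.sub_apply, ← sub_mul, abs_mul] using! this
  calc ∑ n ∈ Finset.range N, |fnConv g h (t (n + 1)) - fnConv g h (t n)|
      ≤ ∑ n ∈ Finset.range N, ∫ y, |g (t (n + 1) - y) - g (t n - y)| * |h y| := by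
        refine Finset.sum_le_sum fun n _ => ?_
        rw [fnConv, fnConv, ← integral_sub (integrable_comp_sub_mul hg hh _)
          (integrable_comp_sub_mul hg hh _)]
        refine abs_integral_le_integral_abs.trans_eq (integral_congr_ae ?_)
        exact Eventually.of_forall fun y => by simp only [← sub_mul, abs_mul]
    _ = ∫ y, (∑ n ∈ Finset.range N, |g (t (n + 1) - y) - g (t n - y)|) * |h y| := by
        rw [← integral_finsetSum _ fun n _ => hi n]
        simp only [Finset.sum_mul]
    _ ≤ ∫ y, variation g * |h y| := by
        refine integral_mono ?_ (hh.abs.const_mul _) fun y => ?_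
        · simp only [Finset.sum_mul]
          exact integrable_finsetSum _ fun n _ => hi n
        · simp only
          gcongr
          exact sum_abs_sub_le_variation (t := fun n => t n - y) hg
            fun n _ => sub_le_sub_right (ht n.le_succ) y
    _ = _ := integral_const_mul _ _

/-- Associativity of the classical convolution, by Fubini's theorem. -/
theorem integral_mul_fnConv {u g h : ℝ → ℝ} (hu : Integrable u) (hg : g ∈ BV) (hh : Integrable h)
    (x : ℝ) : ∫ y, u (x - y) * fnConv g h y = ∫ s, (∫ y, u (x - s - y) * g y) * h s := by
  have hprod : Integrable (fun p : ℝ × ℝ => u (x - p.1) * (g (p.1 - p.2) * h p.2))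
      (volume.prod volume) := by
    have h1 := ((hu.comp_sub_left x).mul_prod hh).mul_bdd (c := |g 0| + variation g)
      (g := fun p : ℝ × ℝ => g (p.1 - p.2))
      ((measurable_of_mem_BV hg).comp (measurable_fst.sub measurable_snd)).aestronglyMeasurable
      (Eventually.of_forall fun p => abs_le_of_mem_BV hg _)
    refine h1.congr (Eventually.of_forall fun p => ?_)
    simp only
    ring
  simp only [fnConv, ← integral_const_mul]
  rw [integral_integral_swap hprod]
  refine integral_congr_ae (Eventually.of_forall fun s => ?_)
  simp only
  rw [← integral_mul_const, ← integral_sub_right_eq_self (fun y => u (x - s - y) * g y * h s) s]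
  refine integral_congr_ae (Eventually.of_forall fun y => ?_)
  simp only [sub_sub_sub_cancel_right, mul_assoc]

theorem integrable_conv_comp_sub_mul {f : Distr} (hf : f ∈ AC) {g h : ℝ → ℝ} (hg : g ∈ BV)
    (hh : Integrable h) (x : ℝ) : Integrable fun y => conv f g (x - y) * h y :=
  hh.bdd_mul ((continuous_conv hf hg).comp (continuous_const.sub continuous_id)).aestronglyMeasurable
    (Eventually.of_forall fun y => abs_conv_le hf hg (x - y))

theorem conv_fnConv {f : Distr} (hf : f ∈ AC) {g h : ℝ → ℝ} (hg : g ∈ BV) (hh : Integrable h) :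
    conv f (fnConv g h) = fnConv (conv f g) h := by
  obtain ⟨u, huc, hus, -, hu⟩ := exists_approx_seq hf
  ext x
  refine tendsto_nhds_unique ((hu _ (fnConv_mem_BV hg hh)).2.tendsto_at x) ?_
  simp only [integral_mul_fnConv ((huc _).integrable_of_hasCompactSupport (hus _)) hg hh]
  obtain ⟨C, hC⟩ := bddAbove_abs_conv hf hg
  have hunif := (hu g hg).2
  refine tendsto_integral_filter_of_dominated_convergence (fun s => (C + 1) * |h s|)
    (Eventually.of_forall fun n => ?_) ?_ (hh.abs.const_mul _)
    (Eventually.of_forall fun s => (hunif.tendsto_at (x - s)).mul_const _)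
  · exact ((continuous_integral_comp_sub_mul (huc n) (hus n) hg).comp
      (continuous_const.sub continuous_id)).aestronglyMeasurable.mul hh.aestronglyMeasurable
  · filter_upwards [Metric.tendstoUniformly_iff.1 hunif 1 one_pos] with n hn
    refine Eventually.of_forall fun s => ?_
    have h1 := hn (x - s)
    rw [Real.dist_eq, abs_sub_comm] at h1
    have h2 := hC ⟨x - s, rfl⟩
    rw [norm_mul, Real.norm_eq_abs, Real.norm_eq_abs]
    gcongr
    have := abs_sub_abs_le_abs_sub (∫ y, u n (x - s - y) * g y) (conv f g (x - s))
    simp only at h2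
    linarith

/-! ### Translations -/

theorem conv_translateDist (f : Distr) (g : ℝ → ℝ) (x z : ℝ) :
    conv (translateDist z f) g x = conv f g (x - z) := by
  rw [conv, reflectDist_translateDist, conv]

theorem conv_comp_sub_const {f : Distr} (hf : f ∈ AC) {g : ℝ → ℝ} (hg : g ∈ BV) (x z : ℝ) :
    conv f (fun y => g (y - z)) x = conv f g (x - z) := by
  rw [conv_eq_mulIntegral hf (comp_sub_const_mem_BV hg z), conv_eq_mulIntegral hf hg]
  simp only [sub_right_comm]

/-! ### Supports -/

theorem exists_isOpen_ordConnected_subset {z : EReal} {s : Set EReal} (hs : s ∈ 𝓝 z) :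
    ∃ U ⊆ s, z ∈ U ∧ IsOpen U ∧ U.OrdConnected := by
  rcases eq_or_ne z ⊥ with rfl | hb
  · obtain ⟨b, hb, h⟩ := exists_Ico_subset_of_mem_nhds hs ⟨⊤, bot_lt_top⟩
    exact ⟨Iio b, fun w hw => h ⟨bot_le, hw⟩, hb, isOpen_Iio, ordConnected_Iio⟩
  rcases eq_or_ne z ⊤ with rfl | ht
  · obtain ⟨a, ha, h⟩ := exists_Ioc_subset_of_mem_nhds hs ⟨⊥, bot_lt_top⟩
    exact ⟨Ioi a, fun w hw => h ⟨hw, le_top⟩, ha, isOpen_Ioi, ordConnected_Ioi⟩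
  obtain ⟨a, b, hz, h⟩ := (mem_nhds_iff_exists_Ioo_subset' ⟨⊥, bot_lt_iff_ne_bot.2 hb⟩
    ⟨⊤, lt_top_iff_ne_top.2 ht⟩).1 hs
  exact ⟨Ioo a b, h, hz, isOpen_Ioo, ordConnected_Ioo⟩

/-- If near every real point `F` is constant or `k` vanishes, then `∫ F dk = F(∞) k(∞)`. -/
theorem hasParts_zero_of_local {F k : ℝ → ℝ} (hF : F ∈ BC) (hk : k ∈ BV)
    (h : ∀ z, (∀ᶠ x in 𝓝 z, F x = F z) ∨ ∀ᶠ x in 𝓝 z, k x = 0) : HasParts F k 0 := by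
  obtain ⟨-, hb, l, hl⟩ := hF
  have hkV := boundedVariationOn_extendReal hk
  set E := extendReal F with hE
  set K := extendReal k with hK
  obtain ⟨B, hB0, hB⟩ : ∃ B > 0, ∀ w, |K w| ≤ B := by
    refine ⟨|K 0| + (eVariationOn K univ).toReal + 1,
      by have := ENNReal.toReal_nonneg (a := eVariationOn K univ); positivity, fun w => ?_⟩
    have h1 := hkV.dist_le (mem_univ w) (mem_univ 0)
    rw [Real.dist_eq] at h1
    linarith [abs_sub_abs_le_abs_sub (K w) (K 0)]
  -- `V` increases by at least `1` over an interval with an infinite endpoint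
  let V : EReal → ℝ := fun w => (if w = ⊤ then 1 else 0) - if w = ⊥ then 1 else 0
  have hV0 : ∀ t t', t < t' → 0 ≤ V t' - V t := fun t t' htt => by
    have h1 := (bot_le.trans_lt htt).ne'
    have h2 := (htt.trans_le le_top).ne
    simp only [V, h1, h2, if_false]
    split_ifs <;> norm_num
  have hVt : ∀ t, t < ⊤ → 1 ≤ V ⊤ - V t := fun t htt => by
    simp only [V, htt.ne, top_ne_bot, if_true, if_false]
    split_ifs <;> norm_num
  have hVb : ∀ t, ⊥ < t → 1 ≤ V t - V ⊥ := fun t htt => by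
    simp only [V, htt.ne', bot_ne_top, if_true, if_false]
    split_ifs <;> norm_num
  have hid : ∀ t z t', E z * (K t' - K t) - (E t' * K t' - E t * K t) =
      (E t - E z) * K t - (E t' - E z) * K t' := fun t z t' => by ring
  have hHS : HasHSIntegral E K (E ⊤ * K ⊤ - E ⊥ * K ⊥) := by
    refine hasHSIntegral_of_local (fun w => E w * K w) V fun ε hε => ?_
    have hloc : ∀ z, ∃ U, z ∈ U ∧ IsOpen U ∧ U.OrdConnected ∧ ∀ t t', t < t' → z ∈ Icc t t' →
        Icc t t' ⊆ U → |(E t - E z) * K t - (E t' - E z) * K t'| ≤ ε * (V t' - V t) := by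
      have hend : ∀ z, Tendsto E (𝓝 z) (𝓝 (E z)) → ∃ U, z ∈ U ∧ IsOpen U ∧ U.OrdConnected ∧
          ∀ t ∈ U, |(E t - E z) * K t| ≤ ε := fun z hz => by
        have h1 : ∀ᶠ t in 𝓝 z, |E t - E z| < ε / B := by
          simpa only [Real.dist_eq] using Metric.tendsto_nhds.1 hz (ε / B) (by positivity)
        obtain ⟨U, hU, h2, h3, h4⟩ := exists_isOpen_ordConnected_subset h1
        refine ⟨U, h2, h3, h4, fun t ht => ?_⟩
        rw [abs_mul, ← div_mul_cancel₀ ε hB0.ne']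
        exact mul_le_mul (hU ht).le (hB t) (abs_nonneg _) (by positivity)
      intro z
      induction z with
      | bot =>
        obtain ⟨U, h1, h2, h3, h4⟩ := hend ⊥ (by
          rw [hE, extendReal_bot hb]; exact tendsto_extendReal_bot hb)
        refine ⟨U, h1, h2, h3, fun t t' htt hz hU => ?_⟩
        obtain rfl : t = ⊥ := le_bot_iff.1 hz.1
        rw [sub_self, zero_mul, zero_sub, abs_neg]
        have := hVb t' htt
        have := h4 t' (hU ⟨htt.le, le_rfl⟩)
        nlinarith
      | top =>
        obtain ⟨U, h1, h2, h3, h4⟩ := hend ⊤ (by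
          rw [hE, extendReal_top hl]; exact tendsto_extendReal_top hl)
        refine ⟨U, h1, h2, h3, fun t t' htt hz hU => ?_⟩
        obtain rfl : t' = ⊤ := top_le_iff.1 hz.2
        rw [sub_self, zero_mul, sub_zero]
        have := hVt t htt
        have := h4 t (hU ⟨le_rfl, htt.le⟩)
        nlinarith
      | coe x =>
        have h1 : ∀ᶠ t in 𝓝 (x : EReal), (E t - E x) * K t = 0 := by
          rw [EReal.nhds_coe, eventually_map]
          rcases h x with h | h
          · filter_upwards [h] with y hy
            simp [hE, hy]
          · filter_upwards [h] with y hy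
            simp [hK, hy]
        obtain ⟨U, hU, h2, h3, h4⟩ := exists_isOpen_ordConnected_subset h1
        refine ⟨U, h2, h3, h4, fun t t' htt _ hs => ?_⟩
        have e1 : (E t - E x) * K t = 0 := hU (hs ⟨le_rfl, htt.le⟩)
        have e2 : (E t' - E x) * K t' = 0 := hU (hs ⟨htt.le, le_rfl⟩)
        rw [e1, e2, sub_zero, abs_zero]
        exact mul_nonneg hε.le (hV0 t t' htt)
    choose γ hγ₁ hγ₂ hγ₃ hγ₄ using hloc
    refine ⟨γ, fun z => ⟨hγ₁ z, hγ₂ z, hγ₃ z⟩, fun t z t' htt hz hs => ?_⟩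
    rw [hid]
    exact hγ₄ z t t' htt hz hs
  refine ⟨_, hHS, ?_⟩
  rw [hE, extendReal_bot hb]
  ring

/-- If `z ∈ supp f`, then `x - z ∉ supp g`, so `g(x - ·)` vanishes near `z`; otherwise the
primitive of `f` is constant near `z`. -/
theorem conv_eq_zero_of_notMem {f : Distr} (hf : f ∈ AC) {g : ℝ → ℝ} (hg : g ∈ BV) {x : ℝ}
    (hx : x ∉ Distribution.dsupport f + tsupport g) : conv f g x = 0 := by
  rw [conv_eq_mulIntegral hf hg]
  refine mulIntegral_eq (hasParts_zero_of_local (primitive_mem_BC hf)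
    (comp_const_sub_mem_BV hg x) fun z => ?_)
  by_cases hz : z ∈ Distribution.dsupport f
  · right
    have h1 : x - z ∉ tsupport g := fun h => hx ⟨z, hz, x - z, h, by simp⟩
    have h2 : Tendsto (fun y => x - y) (𝓝 z) (𝓝 (x - z)) := by
      exact (continuous_const.sub continuous_id).tendsto z
    exact h2.eventually (notMem_tsupport_iff_eventuallyEq.1 h1)
  · exact Or.inl (primitive_eventually_eq hf hz)

/-! ### Convolution as a bounded operator -/

theorem supNorm_smul {c : ℝ} (hc : 0 ≤ c) (k : ℝ → ℝ) : supNorm (c • k) = c * supNorm k := by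
  simp only [supNorm, Real.mul_iSup_of_nonneg hc, Pi.smul_apply, smul_eq_mul, abs_mul,
    abs_of_nonneg hc]

/-- A linear map into `C⁰(ℝ̄)` that is bounded with constant `B`, for a sub-homogeneous
functional `NV` that takes the value `1`, has an operator norm, which is at most `B`. -/
theorem exists_hasOperatorNorm {V : Type} [AddCommGroup V] [Module ℝ V] {NV : V → ℝ}
    (Φ : V →ₗ[ℝ] C0bar) {B : ℝ} (hnn : ∀ v, 0 ≤ NV v) (hsmul : ∀ c > 0, ∀ v, NV (c • v) ≤ c * NV v)
    (hB : ∀ v, supNorm (Φ v) ≤ B * NV v) (hone : ∃ v, NV v = 1) :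
    ∃ C, HasOperatorNorm NV (fun k : C0bar => supNorm k) Φ C ∧ C ≤ B := by
  set S := {r | ∃ v, NV v = 1 ∧ r = supNorm (Φ v)} with hS
  have hne : S.Nonempty := let ⟨v, hv⟩ := hone; ⟨_, v, hv, rfl⟩
  have hSB : ∀ r ∈ S, r ≤ B := by
    rintro _ ⟨v, hv, rfl⟩
    simpa [hv] using hB v
  refine ⟨sSup S, ⟨fun v => ?_, isLUB_csSup hne ⟨B, hSB⟩⟩, csSup_le hne hSB⟩
  rcases (hnn v).eq_or_lt with h0 | hpos
  · have := hB v
    rwa [← h0, mul_zero] at this ⊢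
  have hinv : 0 < (NV v)⁻¹ := inv_pos.2 hpos
  have hunit : NV ((NV v)⁻¹ • v) = 1 := by
    refine le_antisymm ((hsmul _ hinv v).trans_eq (inv_mul_cancel₀ hpos.ne')) ?_
    have := hsmul _ hpos ((NV v)⁻¹ • v)
    rw [smul_inv_smul₀ hpos.ne'] at this
    nlinarith
  have := le_csSup ⟨B, hSB⟩ ⟨_, hunit, rfl⟩
  have e : ((Φ ((NV v)⁻¹ • v) : C0bar) : ℝ → ℝ) = (NV v)⁻¹ • (Φ v : ℝ → ℝ) := by
    rw [map_smul]
    rfl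
  rw [e, supNorm_smul hinv.le, inv_mul_le_iff₀ hpos, mul_comm] at this
  exact this

/-- If the bound `B` is attained at an element of norm `1`, it is the operator norm. -/
theorem hasOperatorNorm_of_attained {V : Type} [AddCommGroup V] [Module ℝ V] {NV : V → ℝ}
    {Φ : V →ₗ[ℝ] C0bar} {B : ℝ} (hB : ∀ v, supNorm (Φ v) ≤ B * NV v) {v : V} (hv : NV v = 1)
    (hΦ : supNorm (Φ v) = B) : HasOperatorNorm NV (fun k : C0bar => supNorm k) Φ B := by
  refine ⟨hB, IsGreatest.isLUB ⟨⟨v, hv, hΦ.symm⟩, ?_⟩⟩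
  rintro _ ⟨w, hw, rfl⟩
  simpa [hw] using hB w

theorem conv_linearComb_right {f : Distr} (hf : f ∈ AC) {g₁ g₂ : ℝ → ℝ} (hg₁ : g₁ ∈ BV)
    (hg₂ : g₂ ∈ BV) (a b : ℝ) : conv f (a • g₁ + b • g₂) = a • conv f g₁ + b • conv f g₂ := by
  ext x
  have hr := reflectDist_mem_AC hf x
  exact mulIntegral_eq (HasParts.linearComb_right hg₁ hg₂ a b (hasParts_mulIntegral hr hg₁)
    (hasParts_mulIntegral hr hg₂))

theorem conv_linearComb_left {f₁ f₂ : Distr} (hf₁ : f₁ ∈ AC) (hf₂ : f₂ ∈ AC) {g : ℝ → ℝ}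
    (hg : g ∈ BV) (a b : ℝ) : conv (a • f₁ + b • f₂) g = a • conv f₁ g + b • conv f₂ g := by
  ext x
  rw [Pi.add_apply, Pi.smul_apply, Pi.smul_apply,
    conv_eq_mulIntegral (AC.add_mem (AC.smul_mem a hf₁) (AC.smul_mem b hf₂)) hg,
    conv_eq_mulIntegral hf₁ hg, conv_eq_mulIntegral hf₂ hg]
  have hx := comp_const_sub_mem_BV hg x
  refine mulIntegral_eq ?_
  rw [HasMulIntegral, primitive_linearComb hf₁ hf₂]
  exact HasParts.linearComb_left (primitive_mem_BC hf₁) (primitive_mem_BC hf₂) a b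
    (hasParts_mulIntegral hf₁ hx) (hasParts_mulIntegral hf₂ hx)

/-- The operator `g ↦ f ∗ g` from `BV` to `C⁰(ℝ̄)`. -/
noncomputable def convBV {f : Distr} (hf : f ∈ AC) : BV →ₗ[ℝ] C0bar where
  toFun g := ⟨conv f g, conv_mem_C0bar hf g.2⟩
  map_add' g₁ g₂ := Subtype.ext <| by
    simpa using! conv_linearComb_right hf g₁.2 g₂.2 1 1
  map_smul' c g := Subtype.ext <| by
    simpa using! conv_linearComb_right hf g.2 g.2 c 0

/-- The operator `f ↦ f ∗ g` from `A_C` to `C⁰(ℝ̄)`. -/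
noncomputable def convAC {g : ℝ → ℝ} (hg : g ∈ BV) : AC →ₗ[ℝ] C0bar where
  toFun f := ⟨conv f g, conv_mem_C0bar f.2 hg⟩
  map_add' f₁ f₂ := Subtype.ext <| by
    simpa using! conv_linearComb_left f₁.2 f₂.2 hg 1 1
  map_smul' c f := Subtype.ext <| by
    simpa using! conv_linearComb_left f.2 f.2 hg c 0

theorem supNorm_conv_le_alexNorm_mul_bvNorm {f : Distr} (hf : f ∈ AC) {g : ℝ → ℝ} (hg : g ∈ BV) :
    supNorm (conv f g) ≤ alexNorm f * bvNorm g :=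
  (supNorm_conv_le hf hg).trans (estimate_le_alexNorm_mul_bvNorm hf hg)

theorem bvNorm_nonneg (g : ℝ → ℝ) : 0 ≤ bvNorm g := add_nonneg (abs_nonneg _) (variation_nonneg g)

theorem bvNorm_smul_le {g : ℝ → ℝ} (hg : g ∈ BV) {c : ℝ} (hc : 0 ≤ c) :
    bvNorm (c • g) ≤ c * bvNorm g := by
  obtain ⟨l, hl⟩ := exists_tendsto_atBot_of_mem_BV hg
  have hl' : Tendsto (c • g) atBot (𝓝 (c * l)) := hl.const_smul c
  have hV : eVariationOn (c • g) univ ≤ ‖c‖₊ * eVariationOn g univ :=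
    ((lipschitzWith_smul (β := ℝ) c).lipschitzOnWith (s := univ)).comp_eVariationOn_le
      (mapsTo_univ _ _)
  have hV' := ENNReal.toReal_mono (ENNReal.mul_ne_top ENNReal.coe_ne_top hg) hV
  rw [ENNReal.toReal_mul, ENNReal.coe_toReal, coe_nnnorm, Real.norm_of_nonneg hc] at hV'
  rw [bvNorm, bvNorm, hl.limUnder_eq, hl'.limUnder_eq, abs_mul, abs_of_nonneg hc, mul_add]
  gcongr
  exact hV'

theorem alexNorm_smul_le {f : Distr} (hf : f ∈ AC) {c : ℝ} (hc : 0 ≤ c) :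
    alexNorm (c • f) ≤ c * alexNorm f := by
  refine csSup_le ⟨_, 0, 0, le_rfl, rfl⟩ ?_
  rintro _ ⟨a, b, -, rfl⟩
  obtain ⟨-, hb, l, hl⟩ := primitive_mem_BC hf
  have hp : primitive (c • f) = c • primitive f + (0 : ℝ) • primitive f := by
    simpa using primitive_linearComb hf hf c 0
  have e : acIntegral (c • f) a b = c * acIntegral f a b := by
    rw [acIntegral, acIntegral, hp, extendReal_linearComb hb hl hb hl]
    simp only [zero_smul, add_zero, Pi.smul_apply, smul_eq_mul, mul_sub]
  rw [e, abs_mul, abs_of_nonneg hc]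
  gcongr
  exact abs_acIntegral_le hf a b

theorem one_mem_BV : (1 : ℝ → ℝ) ∈ BV :=
  (eVariationOn.constant_on (f := (1 : ℝ → ℝ)) (s := univ)
    (by rintro _ ⟨_, _, rfl⟩ _ ⟨_, _, rfl⟩; rfl)).trans_ne ENNReal.zero_ne_top

theorem bvNorm_one : bvNorm 1 = 1 := by
  have h : Tendsto (1 : ℝ → ℝ) atBot (𝓝 1) := tendsto_const_nhds
  have hV : eVariationOn (1 : ℝ → ℝ) univ = 0 :=
    eVariationOn.constant_on (by rintro _ ⟨_, _, rfl⟩ _ ⟨_, _, rfl⟩; rfl)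
  simp [bvNorm, variation, h.limUnder_eq, hV]

theorem conv_one {f : Distr} (hf : f ∈ AC) (x : ℝ) : conv f 1 x = acIntegral f ⊥ ⊤ := by
  obtain ⟨u, -, -, hu0, hu⟩ := exists_approx_seq hf
  refine tendsto_nhds_unique ((hu 1 one_mem_BV).2.tendsto_at x) ?_
  simpa [integral_sub_left_eq_self] using hu0

/-- The characteristic function of `[0, 1]`, as an integrable distribution, has Alexiewicz norm
and integral equal to `1`. -/
theorem exists_alexNorm_eq_one : ∃ f ∈ AC, alexNorm f = 1 ∧ acIntegral f ⊥ ⊤ = 1 := by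
  set u : ℝ → ℝ := (Icc 0 1).indicator 1 with hu
  have hui : Integrable u := (integrable_indicator_iff measurableSet_Icc).2
    (continuous_const.integrableOn_Icc)
  have hu1 : ∫ s, u s = 1 := by
    rw [hu, integral_indicator_one measurableSet_Icc]
    simp
  have hua : (fun s => |u s|) = u :=
    funext fun s => abs_of_nonneg (indicator_nonneg (fun _ _ => zero_le_one) s)
  have hmono : Monotone (lebPrim u) := hua ▸ monotone_lebPrim_abs hui
  have hprim : IsPrimitive (fun x : ℝ => lebPrim u x)
      (∂_{(1 : ℝ)} (regularDist fun x : ℝ => lebPrim u x)) := ⟨lebPrim_mem_BC hui, rfl⟩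
  have hf : ∂_{(1 : ℝ)} (regularDist fun x : ℝ => lebPrim u x) ∈ AC := ⟨_, hprim⟩
  have hac : ∀ a b, acIntegral (∂_{(1 : ℝ)} (regularDist fun x : ℝ => lebPrim u x)) a b =
      lebPrim u b - lebPrim u a := fun a b => by
    rw [acIntegral, hprim.primitive_eq, extendReal_lebPrim hui]
  have h1 : acIntegral (∂_{(1 : ℝ)} (regularDist fun x : ℝ => lebPrim u x)) ⊥ ⊤ = 1 := by
    rw [hac, lebPrim_top, lebPrim_bot, hu1, sub_zero]
  refine ⟨_, hf, le_antisymm (csSup_le ⟨_, 0, 0, le_rfl, rfl⟩ ?_) ?_, h1⟩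
  · rintro _ ⟨a, b, hab, rfl⟩
    have h2 := hmono (bot_le : ⊥ ≤ a)
    have h3 := hmono (le_top : b ≤ ⊤)
    rw [lebPrim_bot] at h2
    rw [lebPrim_top, hu1] at h3
    rw [hac, abs_of_nonneg (sub_nonneg.2 (hmono hab))]
    linarith
  · have := abs_acIntegral_le hf ⊥ ⊤
    rwa [h1, abs_one] at this

theorem ne_zero_of_acIntegral_eq_one {f : Distr} (hf : f ∈ AC) (h : acIntegral f ⊥ ⊤ = 1) :
    f ≠ 0 := by
  rintro rfl
  have hp : primitive (0 : Distr) = 0 := by simpa using primitive_linearComb hf hf 0 0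
  have h0 : Tendsto (0 : ℝ → ℝ) atTop (𝓝 0) := tendsto_const_nhds
  rw [acIntegral_bot_top hf, hp, extendReal_top h0] at h
  exact zero_ne_one h

theorem supNorm_conv_one {f : Distr} (hf : f ∈ AC) :
    supNorm (conv f 1) = |acIntegral f ⊥ ⊤| := by
  simp [supNorm, conv_one hf]

end ContPrimInt
theorem mainTheorem1 :
    (∀ f ∈ AC, ∀ g ∈ BV,
      -- (a) existence of the convolution at every point
      (∀ x, reflectDist x f ∈ AC ∧ ∃! I, HasMulIntegral (reflectDist x f) g I) ∧
      -- (b) commutativity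
      ((∀ x, ∃! I, HasMulIntegral f (fun y => g (x - y)) I) ∧ conv f g = convSwap g f) ∧
      -- (c) estimates in the uniform norm
      (BddAbove (range fun x => |conv f g x|) ∧
        supNorm (conv f g) ≤ |acIntegral f ⊥ ⊤| * (⨅ x, |g x|) + alexNorm f * variation g ∧
        |acIntegral f ⊥ ⊤| * (⨅ x, |g x|) + alexNorm f * variation g ≤
          alexNorm f * bvNorm g) ∧
      -- (d) continuity on the extended real line, and the limits
      (conv f g ∈ C0bar ∧
        (∃ l, Tendsto g atTop (𝓝 l) ∧
          Tendsto (conv f g) atTop (𝓝 (l * acIntegral f ⊥ ⊤))) ∧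
        (∃ l, Tendsto g atBot (𝓝 l) ∧
          Tendsto (conv f g) atBot (𝓝 (l * acIntegral f ⊥ ⊤)))) ∧
      -- (e) associativity
      (∀ h : ℝ → ℝ, Integrable h →
        (∀ x, Integrable fun y => g (x - y) * h y) ∧ fnConv g h ∈ BV ∧
        (∀ x, Integrable fun y => conv f g (x - y) * h y) ∧
        conv f (fnConv g h) = fnConv (conv f g) h ∧ conv f (fnConv g h) ∈ C0bar) ∧
      -- (f) translations
      (∀ z, translateDist z f ∈ AC ∧ (fun y => g (y - z)) ∈ BV ∧
        ∀ x, conv f g (x - z) = conv (translateDist z f) g x ∧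
          conv (translateDist z f) g x = conv f (fun y => g (y - z)) x) ∧
      -- (h) supports
      ((∀ x, conv f g x ≠ 0 → x ∈ Distribution.dsupport f + tsupport g) ∧
        tsupport (conv f g) ⊆ closure (Distribution.dsupport f + tsupport g) ∧
        (IsClosed (Distribution.dsupport f + tsupport g) →
          tsupport (conv f g) ⊆ Distribution.dsupport f + tsupport g))) ∧
    -- (g) the operators `g ↦ f ∗ g`
    (∀ f ∈ AC, ∃ Φ : BV →ₗ[ℝ] C0bar, (∀ g, (Φ g : ℝ → ℝ) = conv f g) ∧
      ∃ C, HasOperatorNorm (fun g : BV => bvNorm g)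
        (fun k : C0bar => supNorm k) Φ C ∧ C ≤ alexNorm f) ∧
    (∃ f ∈ AC, f ≠ 0 ∧ ∃ Φ : BV →ₗ[ℝ] C0bar, (∀ g, (Φ g : ℝ → ℝ) = conv f g) ∧
      HasOperatorNorm (fun g : BV => bvNorm g)
        (fun k : C0bar => supNorm k) Φ (alexNorm f)) ∧
    -- (g) the operators `f ↦ f ∗ g`
    (∀ g ∈ BV, ∃ Ψ : AC →ₗ[ℝ] C0bar, (∀ f, (Ψ f : ℝ → ℝ) = conv f g) ∧
      ∃ C, HasOperatorNorm (fun f : AC => alexNorm f)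
        (fun k : C0bar => supNorm k) Ψ C ∧ C ≤ bvNorm g) ∧
    (∃ g ∈ BV, g ≠ 0 ∧ ∃ Ψ : AC →ₗ[ℝ] C0bar, (∀ f, (Ψ f : ℝ → ℝ) = conv f g) ∧
      HasOperatorNorm (fun f : AC => alexNorm f)
        (fun k : C0bar => supNorm k) Ψ (bvNorm g)) := by
  refine ⟨fun f hf g hg => ⟨fun x => ?_, ⟨fun x => ?_, ?_⟩, ⟨bddAbove_abs_conv hf hg,
    supNorm_conv_le hf hg, estimate_le_alexNorm_mul_bvNorm hf hg⟩, ⟨conv_mem_C0bar hf hg, ?_, ?_⟩,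
    fun h hh => ⟨integrable_comp_sub_mul hg hh, fnConv_mem_BV hg hh,
      integrable_conv_comp_sub_mul hf hg hh, conv_fnConv hf hg hh,
      conv_mem_C0bar hf (fnConv_mem_BV hg hh)⟩,
    fun z => ⟨translateDist_mem_AC hf z, comp_sub_const_mem_BV hg z, fun x => ?_⟩, ?_⟩,
    fun f hf => ?_, ?_, fun g hg => ?_, ?_⟩
  · exact ⟨reflectDist_mem_AC hf x, existsUnique_hasMulIntegral (reflectDist_mem_AC hf x) hg⟩
  · exact existsUnique_hasMulIntegral hf (comp_const_sub_mem_BV hg x)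
  · exact funext (conv_eq_mulIntegral hf hg)
  · obtain ⟨l, hl⟩ := exists_tendsto_atTop_of_mem_BV hg
    exact ⟨l, hl, tendsto_conv_atTop hf hg hl⟩
  · obtain ⟨l, hl⟩ := exists_tendsto_atBot_of_mem_BV hg
    exact ⟨l, hl, tendsto_conv_atBot hf hg hl⟩
  · rw [conv_translateDist, conv_comp_sub_const hf hg]
    exact ⟨rfl, rfl⟩
  · have hs : Function.support (conv f g) ⊆ Distribution.dsupport f + tsupport g := fun x hx =>
      by_contra fun h => hx (conv_eq_zero_of_notMem hf hg h)
    exact ⟨fun x hx => hs hx, closure_mono hs, fun hcl => closure_minimal hs hcl⟩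
  · exact ⟨convBV hf, fun _ => rfl, exists_hasOperatorNorm _ (fun g => bvNorm_nonneg g)
      (fun c hc g => bvNorm_smul_le g.2 hc.le)
      (fun g => supNorm_conv_le_alexNorm_mul_bvNorm hf g.2) ⟨⟨1, one_mem_BV⟩, bvNorm_one⟩⟩
  · obtain ⟨f, hf, hn, hi⟩ := exists_alexNorm_eq_one
    refine ⟨f, hf, ne_zero_of_acIntegral_eq_one hf hi, convBV hf, fun _ => rfl,
      hasOperatorNorm_of_attained (fun g => supNorm_conv_le_alexNorm_mul_bvNorm hf g.2)
        (v := ⟨1, one_mem_BV⟩) bvNorm_one ?_⟩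
    exact (supNorm_conv_one hf).trans (by rw [hi, hn, abs_one])
  · obtain ⟨f₁, hf₁, hn₁, -⟩ := exists_alexNorm_eq_one
    exact ⟨convAC hg, fun _ => rfl, exists_hasOperatorNorm _ (fun f => alexNorm_nonneg f.2)
      (fun c hc f => alexNorm_smul_le f.2 hc.le)
      (fun f => (supNorm_conv_le_alexNorm_mul_bvNorm f.2 hg).trans_eq (mul_comm _ _))
      ⟨⟨f₁, hf₁⟩, hn₁⟩⟩
  · obtain ⟨f, hf, hn, hi⟩ := exists_alexNorm_eq_one
    refine ⟨1, one_mem_BV, one_ne_zero, convAC one_mem_BV, fun _ => rfl,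
      hasOperatorNorm_of_attained (fun f => (supNorm_conv_le_alexNorm_mul_bvNorm f.2
        one_mem_BV).trans_eq (mul_comm _ _)) (v := ⟨f, hf⟩) hn ?_⟩
    exact (supNorm_conv_one hf).trans (by rw [hi, bvNorm_one, abs_one])
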